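/- Let $\mathcal X\subset\mathbb R$ be countable, let $\mathcal X_2=\{(k,l)\in\mathcal X^2: k\ne l\}$ carry a (strict) total order $\prec$, and for each $(k,l)\in\mathcal X_2$ let $\lambda_{kl}:[0,\infty)\to(0,\infty)$ be bounded and measurable. Write $\|\cdot\|_\infty$ for the $L^\infty$ norm on $[0,\infty)$ and $\lambda_k(y)=\sum_{l\ne k}\lambda_{kl}(y)$, and assume (A1) $\sum_{(k,l)\in\mathcal X_2}\|\lambda_{kl}\|_\infty<\infty$; (A2) $\lim_{y\to\infty}\int_0^y\lambda_k(t)\,dt=\infty$ for every $k\in\mathcal X$. Let $\tilde\lambda_{kl}:[0,\infty)\to(0,\infty)$ be measurable functions with $\lambda_{kl}(y)\le\tilde\lambda_{kl}(y)$ for all $y\ge0$, satisfying (A3) for every $(k,l)\in\mathcal X_2$, $\tilde\lambda_{kl}(y)=\|\lambda_{kl}\|_\infty$ for almost every $y\ge 0$. Define the intervals $$\Lambda_{kl}(y)=\Big(\sum_{(k',l')\prec(k,l)}\tilde\lambda_{k'l'}(y)\Big)+[0,\lambda_{kl}(y))\subset\mathbb R$$ (empty if the sum is infinite), and, for $k\in\mathcal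 X$, $y\ge0$, $v\in\mathbb R$, $$h_\Lambda(k,y,v)=\sum_{l\ne k}(l-k)\mathbf 1_{\Lambda_{kl}(y)}(v),\qquad g_\Lambda(k,y,v)=y\sum_{l\ne k}\mathbf 1_{\Lambda_{kl}(y)}(v).$$ Let $\wp$ be a Poisson random measure on $[0,\infty)\times\mathbb R$ with Lebesgue intensity, on a probability space $(\Omega,\mathcal F,P)$. Let $i,j\in\mathcal X$ with $i\neq j$, let $y_1,y_2\ge0$, and let $(X^1,Y^1)$ and $(X^2,Y^2)$ be $\mathcal X\times[0,\infty)$-valued processes, $X^1,X^2$ having pure jump paths (right continuous with left limits for the discrete topology of $\mathcal X$), which almost surely solve, for all $t>0$, $$X_t=X_0+\int_{(0,t]}\int_{\mathbb R}h_\Lambda(X_{u-},Y_{u-},v)\,\wp(du,dv),\qquad Y_t=Y_0+t-\int_{(0,t]}\int_{\mathbb R}g_\Lambda(X_{u-},Y_{u-},v)\,\wp(du,dv)$$ (with absolutely convergent integrals), driven by the same $\wp$, with initial conditions $(X^1_0,Y^1_0)=(i,y_1)$ and $(X^2_0,Y^2_0)=(j,y_2)$ respectively. Let $T_1=\inf\{t>0: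 X^1_{t-}\ne X^1_t\text{ or }X^2_{t-}\ne X^2_t\}$ be the first collective transition time. The event that $X^1$ and $X^2$ meet at the next transition is $$E=\{T_1<\infty,\ X^1_{T_1}=X^2_{T_1},\ \min(Y^1_{T_1},Y^2_{T_1})=0\}.$$ Then $E$ is measurable up to a $P$-null set, and $$P(E)=\int_0^\infty e^{-\int_0^y(\lambda_i(y_1+t)+\lambda_j(y_2+t))\,dt}\,\big(\lambda_{ij}(y_1+y)+\lambda_{ji}(y_2+y)\big)\,dy,$$ where the integral on the right converges. -/

import Mathlib

open MeasureTheory ProbabilityTheory Filter Topology Set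
open scoped ENNReal NNReal

noncomputable section

namespace SemiMarkovFlow

/-- `N` is a Poisson random measure with intensity `ν` under `P`: an integer-valued random measure
whose value on each measurable `A` is Poisson with mean `ν A` (almost surely infinite if
`ν A = ∞`), and whose values on finitely many disjoint sets are independent. -/
structure IsPoissonRandomMeasure {Ω E : Type*} [MeasurableSpace Ω] [MeasurableSpace E]
    (P : Measure Ω) (N : Ω → Measure E) (ν : Measure E) : Prop where
  measurable : ∀ A, MeasurableSet A → Measurable fun ω => N ω A
  integer_valued : ∀ᵐ ω ∂P, ∀ A, MeasurableSet A → ∃ n : ℕ∞, N ω A = (n : ℝ≥0∞)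
  poisson : ∀ A, MeasurableSet A → ν A ≠ ∞ →
    P.map (fun ω => N ω A) = (poissonMeasure (ν A).toNNReal).map fun n : ℕ => (n : ℝ≥0∞)
  infinite : ∀ A, MeasurableSet A → ν A = ∞ → ∀ᵐ ω ∂P, N ω A = ∞
  indep : ∀ (n : ℕ) (A : Fin n → Set E), (∀ k, MeasurableSet (A k)) →
    Pairwise (fun k l => Disjoint (A k) (A l)) → iIndepFun (fun k ω => N ω (A k)) P

/-- Lebesgue measure on `[0,∞)`, as a measure on `ℝ`. -/
def halfLine : Measure ℝ := volume.restrict (Ici 0)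

/-- The set of ordered pairs of distinct states. -/
abbrev Pairs (S : Set ℝ) : Type := {p : S × S // p.1 ≠ p.2}

/-- The pair `(i, k)` with `k ≠ i`. -/
def pairTo {S : Set ℝ} (i : S) (k : {k : S // k ≠ i}) : Pairs S := ⟨(i, k.1), k.2.symm⟩

/-- The `L^∞` norm of a function on `[0,∞)`. -/
def supNorm (f : ℝ → ℝ) : ℝ := (eLpNorm f ∞ halfLine).toReal

/-- The total rate `λ_i(y) = |λ_{ii}(y)| = ∑_{k ≠ i} λ_{ik}(y)` of leaving `i` at age `y`. -/
def exitRate {S : Set ℝ} (lam : Pairs S → ℝ → ℝ) (i : S) (y : ℝ) : ℝ :=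
  ∑' k : {k : S // k ≠ i}, lam (pairTo i k) y

/-- The standing assumptions on the transition rates. Only the values at ages `y ≥ 0` matter; a
function on `[0,∞)` is represented by any measurable extension to `ℝ`. -/
structure IsRateMatrix {S : Set ℝ} (lam : Pairs S → ℝ → ℝ) : Prop where
  measurable : ∀ p, Measurable (lam p)
  pos : ∀ p, ∀ y, 0 ≤ y → 0 < lam p y
  bounded : ∀ p, ∃ M : ℝ, ∀ y, 0 ≤ y → lam p y ≤ M
  summable_norm : Summable fun p => supNorm (lam p)
  tendsto_cumulative : ∀ i : S,
    Tendsto (fun y : ℝ => ∫ t in (0 : ℝ)..y, exitRate lam i t) atTop atTop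

/-- The assumptions on the auxiliary functions `λ̃` that fix the positions of the intervals. -/
structure IsSpacing {S : Set ℝ} (lam lamT : Pairs S → ℝ → ℝ) : Prop where
  measurable : ∀ p, Measurable (lamT p)
  pos : ∀ p, ∀ y, 0 ≤ y → 0 < lamT p y
  le : ∀ p, ∀ y, 0 ≤ y → lam p y ≤ lamT p y
  le_norm : ∀ p, ∀ᵐ y ∂halfLine, lamT p y ≤ supNorm (lam p)

/-- Assumption (A3): `λ̃_p = ‖λ_p‖_∞` almost everywhere, for all `p`. -/
def AssumptionA3 {S : Set ℝ} (lam lamT : Pairs S → ℝ → ℝ) : Prop :=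
  ∀ p, ∀ᵐ y ∂halfLine, lamT p y = supNorm (lam p)

/-- The sum of `λ̃_q(y)` over the pairs `q` that precede `p`, as an extended nonnegative number. -/
def leftEnd {S : Set ℝ} (r : Pairs S → Pairs S → Prop) (lamT : Pairs S → ℝ → ℝ)
    (p : Pairs S) (y : ℝ) : ℝ≥0∞ :=
  ∑' q : {q : Pairs S // r q p}, ENNReal.ofReal (lamT q.1 y)

/-- The interval `Λ_p(y) = leftEnd + [0, λ_p(y))`, a set of real numbers. (It is empty if the left
end is infinite, which under (A1) and (A3) can happen only for a null set of ages.) -/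
def jumpInterval {S : Set ℝ} (r : Pairs S → Pairs S → Prop) (lam lamT : Pairs S → ℝ → ℝ)
    (p : Pairs S) (y : ℝ) : Set ℝ :=
  {v | 0 ≤ v ∧ leftEnd r lamT p y ≤ ENNReal.ofReal v ∧
    ENNReal.ofReal v < leftEnd r lamT p y + ENNReal.ofReal (lam p y)}

/-- `h_Λ(i,y,v) = ∑_{k ≠ i} (k - i) 1_{Λ_{ik}(y)}(v)`. -/
def hCoeff {S : Set ℝ} (r : Pairs S → Pairs S → Prop) (lam lamT : Pairs S → ℝ → ℝ)
    (i : S) (y v : ℝ) : ℝ :=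
  ∑' k : {k : S // k ≠ i},
    ((k.1 : ℝ) - (i : ℝ)) * (jumpInterval r lam lamT (pairTo i k) y).indicator 1 v

/-- `g_Λ(i,y,v) = y ∑_{k ≠ i} 1_{Λ_{ik}(y)}(v)`. -/
def gCoeff {S : Set ℝ} (r : Pairs S → Pairs S → Prop) (lam lamT : Pairs S → ℝ → ℝ)
    (i : S) (y v : ℝ) : ℝ :=
  y * ∑' k : {k : S // k ≠ i}, (jumpInterval r lam lamT (pairTo i k) y).indicator 1 v

/-- The path `x` (on times `t ≥ 0`) is a pure jump path: right continuous with left limits for the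
discrete topology of the countable state space. -/
def IsPureJumpPath {S : Set ℝ} (x : ℝ → S) : Prop :=
  (∀ t, 0 ≤ t → ∀ᶠ s in 𝓝[>] t, x s = x t) ∧
  (∀ t, 0 < t → ∃ k : S, ∀ᶠ s in 𝓝[<] t, x s = k)

/-- The path `(x, y)` solves
`x_t = x_0 + ∫_{(0,t]×ℝ} h_Λ(x_{u-}, y_{u-}, v) μ(du,dv)`,
`y_t = y_0 + t - ∫_{(0,t]×ℝ} g_Λ(x_{u-}, y_{u-}, v) μ(du,dv)` for all `t > 0`,
with `x_0 = i` and `y_0 = a`, both integrals being absolutely convergent. -/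
structure IsSolutionPath {S : Set ℝ} (r : Pairs S → Pairs S → Prop) (lam lamT : Pairs S → ℝ → ℝ)
    (μ : Measure (ℝ × ℝ)) (i : S) (a : ℝ) (x : ℝ → S) (y : ℝ → ℝ) : Prop where
  init_state : x 0 = i
  init_age : y 0 = a
  age_nonneg : ∀ t, 0 ≤ t → 0 ≤ y t
  pure_jump : IsPureJumpPath x
  integrable_h : ∀ t, 0 < t → IntegrableOn
    (fun z : ℝ × ℝ => hCoeff r lam lamT (Function.leftLim x z.1) (Function.leftLim y z.1) z.2)
    (Ioc 0 t ×ˢ univ) μ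
  integrable_g : ∀ t, 0 < t → IntegrableOn
    (fun z : ℝ × ℝ => gCoeff r lam lamT (Function.leftLim x z.1) (Function.leftLim y z.1) z.2)
    (Ioc 0 t ×ˢ univ) μ
  state_eq : ∀ t, 0 < t → (x t : ℝ) = (x 0 : ℝ) +
    ∫ z in Ioc 0 t ×ˢ univ,
      hCoeff r lam lamT (Function.leftLim x z.1) (Function.leftLim y z.1) z.2 ∂μ
  age_eq : ∀ t, 0 < t → y t = y 0 + t -
    ∫ z in Ioc 0 t ×ˢ univ,
      gCoeff r lam lamT (Function.leftLim x z.1) (Function.leftLim y z.1) z.2 ∂μ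

/-- The process `(X, Y)` is a solution, driven by the random measure `N`, of the system of
stochastic differential equations, with initial state `i` and initial age `a`. -/
def IsSolution {Ω : Type*} [MeasurableSpace Ω] (P : Measure Ω) {S : Set ℝ}
    (r : Pairs S → Pairs S → Prop) (lam lamT : Pairs S → ℝ → ℝ)
    (N : Ω → Measure (ℝ × ℝ)) (i : S) (a : ℝ) (X : ℝ → Ω → S) (Y : ℝ → Ω → ℝ) : Prop :=
  ∀ᵐ ω ∂P, IsSolutionPath r lam lamT (N ω) i a (fun t => X t ω) (fun t => Y t ω)

/-- The transition times of a path: the times `t > 0` with `x_{t-} ≠ x_t`. -/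
def transitionTimes {S : Set ℝ} (x : ℝ → S) : Set ℝ :=
  {t | 0 < t ∧ Function.leftLim x t ≠ x t}

/-- The collective transition times `T_0 = 0`,
`T_{n+1} = inf {t > T_n : t is a transition time of x₁ or of x₂}` (`+∞` if there is none). -/
def collectiveTime {S : Set ℝ} (x₁ x₂ : ℝ → S) : ℕ → EReal
  | 0 => 0
  | n + 1 => sInf {t : EReal | collectiveTime x₁ x₂ n < t ∧
      ∃ s ∈ transitionTimes x₁ ∪ transitionTimes x₂, t = (s : EReal)}

/-- The event that the two processes meet at the next (the first) collective transition: `T_1` is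
finite, and at time `T_1` the states agree and the smaller of the two ages is `0`. -/
def meetsAtNextTransition {Ω : Type*} {S : Set ℝ} (X₁ X₂ : ℝ → Ω → S) (Y₁ Y₂ : ℝ → Ω → ℝ) :
    Set Ω :=
  {ω | ∃ T : ℝ, collectiveTime (fun t => X₁ t ω) (fun t => X₂ t ω) 1 = (T : EReal) ∧
    X₁ T ω = X₂ T ω ∧ min (Y₁ T ω) (Y₂ T ω) = 0}

end SemiMarkovFlow

end

noncomputable section

namespace SemiMarkovFlow

/-! ### Integer-valued measures -/

/-! Until one of the two paths jumps, their states stay `i` and `j` and their ages are `y₁ + u` and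
`y₂ + u`. So the first collective transition is decided by deterministic subsets of the time-mark
plane: `trigger p a` consists of the points `(u, v)` with `v` in the interval of `p` at age `a + u`.
Each such set has density `λ_p(a + u)` in time. By (A3) the values of `λ̃` agree at almost all ages,
so for almost every `u` the intervals of distinct pairs are disjoint even when taken at the two
different ages. Hence almost surely no Poisson point triggers two transitions, and the paths meet at
the next transition exactly when the first point triggers `(i,j)` or `(j,i)`. With `R` the rate of
these two transitions and `R'` the rate of all the others, the first point lies in the first region
with probability `∫ e^{-∫(R+R')} R`, which is the claim.

The argument on paths is deterministic and uses only that the driving measure is integer-valued.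
While the state is constant no effective mark can occur (`ae_gCoeff_eq_zero`): nonnegativity of the
age allows at most one effective mark at a time, and a single one would move the state. Conversely,
the state cannot change without an effective mark (`exists_first_transition`). So if a single
trigger is charged, and only once, up to time `t`, it dictates whether the paths meet
(`meets_iff_mem_meetingLabels`).

The probabilistic part (`measure_eq_of_firstPointIn`) needs neither filtrations nor point
enumerations. On a grid, the event that the first point falls in a given cell and region involves
three independent Poisson counts. This yields the lower bounds `∫ e^{-L} R` and `∫ e^{-L} R'` for
the events of meeting and of not meeting, where `L = ∫(R+R')`. By (A2) these bounds add up to at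
least one, so both are equalities, and the meeting event agrees with a measurable event up to a null
set. -/

/-- A measure all of whose values on measurable sets are natural numbers or `∞`. -/
def IntegerValued {E : Type*} [MeasurableSpace E] (μ : Measure E) : Prop :=
  ∀ A, MeasurableSet A → ∃ n : ℕ∞, μ A = (n : ℝ≥0∞)

namespace IntegerValued

variable {E : Type*} [MeasurableSpace E] {μ : Measure E}

lemma one_le (hμ : IntegerValued μ) {A : Set E} (hA : MeasurableSet A) (h : μ A ≠ 0) :
    1 ≤ μ A := by
  obtain ⟨n, hn⟩ := hμ A hA
  rw [hn] at h ⊢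
  have : n ≠ 0 := by rintro rfl; simp at h
  exact_mod_cast Order.one_le_iff_ne_zero.2 this

lemma eq_one (hμ : IntegerValued μ) {A : Set E} (hA : MeasurableSet A) (h : μ A ≠ 0)
    (h1 : μ A ≤ 1) : μ A = 1 :=
  le_antisymm h1 (hμ.one_le hA h)

/-- A countable union of mass one has a member of mass one. -/
lemma exists_eq_one (hμ : IntegerValued μ) {ι : Type*} [Countable ι] {A : ι → Set E}
    (hA : ∀ k, MeasurableSet (A k)) (h : μ (⋃ k, A k) = 1) : ∃ k, μ (A k) = 1 := by
  by_contra! hne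
  have : μ (⋃ k, A k) = 0 := by
    refine measure_iUnion_null fun k => ?_
    by_contra h0
    exact hne k (hμ.eq_one (hA k) h0 (h ▸ measure_mono (subset_iUnion A k)))
  simp [this] at h

/-- An integer-valued measure which is finite and nonzero on a set of space-time points charges one
of the time slices of this set. -/
lemma exists_slice_ne_zero {μ : Measure (ℝ × ℝ)} (hμ : IntegerValued μ) {H : Set (ℝ × ℝ)}
    (hH : MeasurableSet H) {s : ℝ} (hsub : H ⊆ Ioc 0 s ×ˢ univ) (hfin : μ H ≠ ∞) (h0 : μ H ≠ 0) :
    ∃ u ∈ Ioc 0 s, μ (H ∩ {u} ×ˢ univ) ≠ 0 := by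
  have hmeas : ∀ u : ℝ, MeasurableSet (H ∩ Iic u ×ˢ univ) := fun u =>
    hH.inter (measurableSet_Iic.prod MeasurableSet.univ)
  -- The charged slice sits at the first time `T = inf K` by which some mass of `H` has been seen.
  set K : Set ℝ := {u | μ (H ∩ Iic u ×ˢ univ) ≠ 0} with hK
  have hsK : s ∈ K := by
    have : H ∩ Iic s ×ˢ univ = H := by
      refine inter_eq_left.2 fun z hz => ?_
      exact ⟨(hsub hz).1.2, trivial⟩
    simpa [hK, this] using h0
  have hbdd : BddBelow K := by
    refine ⟨0, fun u hu => ?_⟩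
    by_contra! hneg
    refine hu ?_
    have : H ∩ Iic u ×ˢ univ = ∅ := by
      refine eq_empty_of_forall_notMem fun z hz => ?_
      have h1 := (hsub hz.1).1.1
      have h2 : z.1 ≤ u := hz.2.1
      linarith
    simp [this]
  set T := sInf K with hT
  have hup : ∀ u, T < u → u ∈ K := by
    intro u hu
    obtain ⟨w, hw, hwu⟩ := exists_lt_of_csInf_lt ⟨s, hsK⟩ hu
    intro h
    refine hw (measure_mono_null ?_ h)
    gcongr
  have hlow : μ (H ∩ Iio T ×ˢ univ) = 0 := by
    have : H ∩ Iio T ×ˢ univ ⊆ ⋃ n : ℕ, H ∩ Iic (T - 1 / ((n : ℝ) + 1)) ×ˢ univ := by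
      rintro z ⟨hz, hz1, -⟩
      obtain ⟨n, hn⟩ := exists_nat_one_div_lt (sub_pos.2 (mem_Iio.1 hz1))
      refine mem_iUnion.2 ⟨n, hz, ?_, trivial⟩
      simp only [mem_Iic]; linarith
    refine measure_mono_null this (measure_iUnion_null fun n => ?_)
    by_contra h
    have h1 : T ≤ T - 1 / ((n : ℝ) + 1) := csInf_le hbdd h
    have h2 : 0 < 1 / ((n : ℝ) + 1) := by positivity
    linarith
  -- Integer values keep the mass up to `T + 1/(n+1)` at least one, so none is lost in the limit;
  -- continuity from above is where finiteness on `H` is needed.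
  have hle : 1 ≤ μ (H ∩ Iic T ×ˢ univ) := by
    have hlim := tendsto_measure_iInter_atTop (μ := μ)
      (s := fun n : ℕ => H ∩ Iic (T + 1 / ((n : ℝ) + 1)) ×ˢ univ)
      (fun n => (hmeas _).nullMeasurableSet)
      (fun m n hmn => by
        have := Nat.one_div_le_one_div (α := ℝ) hmn
        simp only
        gcongr)
      ⟨0, ne_top_of_le_ne_top hfin (measure_mono inter_subset_left)⟩
    have heq : ⋂ n : ℕ, H ∩ Iic (T + 1 / ((n : ℝ) + 1)) ×ˢ univ = H ∩ Iic T ×ˢ univ := by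
      ext z
      simp only [mem_iInter, mem_inter_iff, mem_prod, mem_Iic, mem_univ, and_true]
      constructor
      · intro h
        refine ⟨(h 0).1, le_of_forall_pos_lt_add fun ε hε => ?_⟩
        obtain ⟨n, hn⟩ := exists_nat_one_div_lt hε
        linarith [(h n).2]
      · rintro ⟨h1, h2⟩ n
        have h3 : 0 < 1 / ((n : ℝ) + 1) := by positivity
        exact ⟨h1, by linarith⟩
    rw [heq] at hlim
    refine ge_of_tendsto hlim (Eventually.of_forall fun n => ?_)
    have h3 : 0 < 1 / ((n : ℝ) + 1) := by positivity
    exact hμ.one_le (hmeas _) (hup _ (by linarith))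
  have hne : μ (H ∩ {T} ×ˢ univ) ≠ 0 := by
    intro h
    have : H ∩ Iic T ×ˢ univ ⊆ (H ∩ Iio T ×ˢ univ) ∪ (H ∩ {T} ×ˢ univ) := by
      rintro z ⟨hz, hz1, -⟩
      rcases lt_or_eq_of_le (mem_Iic.1 hz1) with h | h
      · exact Or.inl ⟨hz, h, trivial⟩
      · exact Or.inr ⟨hz, h, trivial⟩
    have h0 : μ (H ∩ Iic T ×ˢ univ) = 0 := measure_mono_null this (measure_union_null hlow h)
    simp [h0] at hle
  obtain ⟨z, hz, hz1, -⟩ := nonempty_of_measure_ne_zero hne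
  have : z.1 = T := hz1
  exact ⟨T, this ▸ (hsub hz).1, hne⟩

/-- A function which is integrable for an integer-valued measure and vanishes almost
everywhere on each time slice vanishes almost everywhere. -/
lemma ae_eq_zero_of_slices {μ : Measure (ℝ × ℝ)} (hμ : IntegerValued μ) {G : ℝ × ℝ → ℝ} {s : ℝ}
    (hG : IntegrableOn G (Ioc 0 s ×ˢ univ) μ)
    (hslice : ∀ u ∈ Ioc 0 s, ∀ᵐ z ∂μ.restrict ({u} ×ˢ univ), G z = 0) :
    ∀ᵐ z ∂μ.restrict (Ioc 0 s ×ˢ univ), G z = 0 := by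
  have hS : MeasurableSet (Ioc (0 : ℝ) s ×ˢ (univ : Set ℝ)) :=
    measurableSet_Ioc.prod MeasurableSet.univ
  set G' := hG.1.mk G with hG'
  have hGm : Measurable G' := hG.1.stronglyMeasurable_mk.measurable
  have hae : G =ᵐ[μ.restrict (Ioc 0 s ×ˢ univ)] G' := hG.1.ae_eq_mk
  have hint : Integrable G' (μ.restrict (Ioc 0 s ×ˢ univ)) := hG.congr hae
  -- Integrability makes each superlevel set of finite measure; if one were charged, it would charge
  -- a slice, on which the function vanishes.
  have key : ∀ n : ℕ, μ ({z | 1 / ((n : ℝ) + 1) ≤ ‖G' z‖} ∩ Ioc 0 s ×ˢ univ) = 0 := by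
    intro n
    have hm : MeasurableSet {z | 1 / ((n : ℝ) + 1) ≤ ‖G' z‖} :=
      measurableSet_le measurable_const hGm.norm
    by_contra h0
    have hfin : μ ({z | 1 / ((n : ℝ) + 1) ≤ ‖G' z‖} ∩ Ioc 0 s ×ˢ univ) ≠ ∞ := by
      rw [← Measure.restrict_apply hm]
      exact (hint.measure_norm_ge_lt_top (by positivity)).ne
    obtain ⟨u, hu, hne⟩ := hμ.exists_slice_ne_zero (hm.inter hS) inter_subset_right hfin h0
    refine hne ?_
    have hsub : ({u} ×ˢ univ : Set (ℝ × ℝ)) ⊆ Ioc 0 s ×ˢ univ := by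
      gcongr; simpa using hu
    have h2 : ∀ᵐ z ∂μ.restrict ({u} ×ˢ univ), ¬ (1 / ((n : ℝ) + 1) ≤ ‖G' z‖) := by
      filter_upwards [hslice u hu, ae_mono (Measure.restrict_mono hsub le_rfl) hae] with z h1 h2
      rw [← h2, h1, norm_zero, not_le]
      positivity
    rw [ae_iff, Measure.restrict_apply (by simpa using hm)] at h2
    refine measure_mono_null ?_ h2
    rintro z ⟨⟨h3, -⟩, h4⟩
    exact ⟨by simpa using h3, h4⟩
  have hz : ∀ᵐ z ∂μ.restrict (Ioc 0 s ×ˢ univ), ∀ n : ℕ, ¬ (1 / ((n : ℝ) + 1) ≤ ‖G' z‖) := by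
    rw [ae_all_iff]
    intro n
    rw [ae_iff, Measure.restrict_apply
      (by simpa using measurableSet_le measurable_const hGm.norm)]
    simpa using key n
  filter_upwards [hae, hz] with z h1 h2
  rw [h1]
  by_contra hne
  obtain ⟨n, hn⟩ := exists_nat_one_div_lt (norm_pos_iff.2 hne)
  exact h2 n hn.le

end IntegerValued

/-- Left continuity in `t` of integrals over `(0,t) × ℝ`. -/
lemma tendsto_setIntegral_Ioc_nhdsLT {μ : Measure (ℝ × ℝ)} {G : ℝ × ℝ → ℝ} {t : ℝ}
    (hG : IntegrableOn G (Ioc 0 t ×ˢ univ) μ) :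
    Tendsto (fun s => ∫ z in Ioc 0 s ×ˢ univ, G z ∂μ) (𝓝[<] t)
      (𝓝 (∫ z in Ioo 0 t ×ˢ univ, G z ∂μ)) := by
  have hm : ∀ s : ℝ, MeasurableSet (Ioc (0 : ℝ) s ×ˢ (univ : Set ℝ)) := fun s =>
    measurableSet_Ioc.prod MeasurableSet.univ
  have hm' : MeasurableSet (Ioo (0 : ℝ) t ×ˢ (univ : Set ℝ)) :=
    measurableSet_Ioo.prod MeasurableSet.univ
  have hG' : IntegrableOn G (Ioo 0 t ×ˢ univ) μ :=
    hG.mono_set (prod_mono Ioo_subset_Ioc_self subset_rfl)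
  rw [← integral_indicator hm']
  have : (fun s => ∫ z in Ioc 0 s ×ˢ univ, G z ∂μ) =
      fun s => ∫ z, (Ioc (0 : ℝ) s ×ˢ univ).indicator G z ∂μ := by
    ext s; rw [integral_indicator (hm s)]
  rw [this]
  refine tendsto_integral_filter_of_dominated_convergence
    (fun z => ‖(Ioo (0 : ℝ) t ×ˢ univ).indicator G z‖) ?_ ?_
    (hG'.integrable_indicator hm').norm ?_
  · filter_upwards [self_mem_nhdsWithin] with s hs
    refine (aestronglyMeasurable_indicator_iff (hm s)).2 (hG.mono_set ?_).1
    exact prod_mono (Ioc_subset_Ioc_right (mem_Iio.1 hs).le) subset_rfl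
  · filter_upwards [self_mem_nhdsWithin] with s hs
    refine Eventually.of_forall fun z => ?_
    refine norm_indicator_le_of_subset (prod_mono ?_ subset_rfl) G z
    intro w hw
    exact ⟨hw.1, hw.2.trans_lt hs⟩
  · refine Eventually.of_forall fun z => ?_
    refine tendsto_const_nhds.congr' ?_
    by_cases hz : z.1 < t
    · filter_upwards [Ioo_mem_nhdsLT hz] with s hs
      by_cases hz0 : 0 < z.1
      · rw [indicator_of_mem (show z ∈ Ioo (0 : ℝ) t ×ˢ univ from ⟨⟨hz0, hz⟩, trivial⟩),
          indicator_of_mem (show z ∈ Ioc (0 : ℝ) s ×ˢ univ from ⟨⟨hz0, hs.1.le⟩, trivial⟩)]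
      · rw [indicator_of_notMem (fun h => hz0 h.1.1), indicator_of_notMem (fun h => hz0 h.1.1)]
    · filter_upwards [self_mem_nhdsWithin] with s hs
      rw [indicator_of_notMem (fun h => hz h.1.2),
        indicator_of_notMem (fun h => hz (h.1.2.trans_lt hs))]

lemma setIntegral_Ioc_eq_Ioo_add {μ : Measure (ℝ × ℝ)} {G : ℝ × ℝ → ℝ} {t : ℝ} (ht : 0 < t)
    (hG : IntegrableOn G (Ioc 0 t ×ˢ univ) μ) :
    ∫ z in Ioc 0 t ×ˢ univ, G z ∂μ =
      ∫ z in Ioo 0 t ×ˢ univ, G z ∂μ + ∫ z in {t} ×ˢ univ, G z ∂μ := by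
  have h : Ioc 0 t ×ˢ (univ : Set ℝ) = Ioo 0 t ×ˢ univ ∪ {t} ×ˢ univ := by
    rw [← union_prod, Ioo_union_right ht]
  rw [h] at hG ⊢
  refine setIntegral_union ?_ ((measurableSet_singleton t).prod MeasurableSet.univ)
    (hG.mono_set subset_union_left) (hG.mono_set subset_union_right)
  rw [Set.disjoint_left]
  rintro z hz hz'
  have h1 : z.1 = t := hz'.1
  exact absurd hz.1.2 (by simp [h1])

/-! ### The jump intervals -/

section Intervals

variable {S : Set ℝ} {r : Pairs S → Pairs S → Prop} {lam lamT : Pairs S → ℝ → ℝ}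

/-- The slots of lengths `λ̃` are stacked in the given order: the predecessors of `p`, together with
`p` itself, are distinct predecessors of `q`. Sums in `ℝ≥0∞` make this valid without convergence. -/
lemma leftEnd_add_le [IsStrictTotalOrder (Pairs S) r] {p q : Pairs S} (hpq : r p q) (y : ℝ) :
    leftEnd r lamT p y + ENNReal.ofReal (lamT p y) ≤ leftEnd r lamT q y := by
  classical
  have h := fun p' : Pairs S => tsum_subtype {q : Pairs S | r q p'}
    (fun q => ENNReal.ofReal (lamT q y))
  have h1 : leftEnd r lamT p y = _ := h p
  have h2 : leftEnd r lamT q y = _ := h q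
  rw [h1, h2, ← tsum_pi_single p (ENNReal.ofReal (lamT p y)), ← ENNReal.tsum_add]
  refine ENNReal.tsum_le_tsum fun q' => ?_
  by_cases hq' : q' = p
  · subst hq'
    have : ¬ r q' q' := irrefl q'
    simp [indicator, this, hpq]
  · by_cases hr : r q' p
    · have : r q' q := _root_.trans hr hpq
      simp [indicator, hr, this, hq']
    · simp [indicator, hr, hq']

/-- The intervals of distinct pairs are disjoint, even at different ages if `λ̃` takes the same
values there. -/
lemma disjoint_jumpInterval [IsStrictTotalOrder (Pairs S) r] (hsp : IsSpacing lam lamT)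
    {y y' : ℝ} (hy : 0 ≤ y) (hy' : 0 ≤ y') (heq : ∀ q, lamT q y = lamT q y') {p q : Pairs S}
    (hpq : p ≠ q) :
    Disjoint (jumpInterval r lam lamT p y) (jumpInterval r lam lamT q y') := by
  have hle : ∀ p, leftEnd r lamT p y = leftEnd r lamT p y' := fun p => by simp [leftEnd, heq]
  have hr : r p q ∨ r q p := by
    rcases trichotomous_of r p q with h | h | h
    · exact Or.inl h
    · exact absurd h hpq
    · exact Or.inr h
  rw [Set.disjoint_left]
  rintro v ⟨-, h1, h2⟩ ⟨-, h3, h4⟩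
  rcases hr with h | h
  · refine absurd h3 (not_le.2 (h2.trans_le ?_))
    refine le_trans ?_ (leftEnd_add_le (lamT := lamT) h y')
    rw [hle p, ← heq p]
    gcongr
    exact hsp.le p y hy
  · refine absurd h1 (not_le.2 (h4.trans_le ?_))
    refine le_trans ?_ (leftEnd_add_le (lamT := lamT) h y)
    rw [hle q, heq q]
    gcongr
    exact hsp.le q y' hy'

lemma measurableSet_jumpInterval (p : Pairs S) (y : ℝ) :
    MeasurableSet (jumpInterval r lam lamT p y) := by
  unfold jumpInterval
  measurability

lemma measurable_leftEnd [Countable S] (h : IsSpacing lam lamT) (p : Pairs S) :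
    Measurable (leftEnd r lamT p) :=
  Measurable.tsum fun q => (h.measurable q.1).ennreal_ofReal

lemma measurableSet_jumpInterval_joint [Countable S] (hlam : IsRateMatrix lam)
    (hsp : IsSpacing lam lamT) (p : Pairs S) :
    MeasurableSet {z : ℝ × ℝ | z.2 ∈ jumpInterval r lam lamT p z.1} := by
  have h1 : Measurable fun z : ℝ × ℝ => leftEnd r lamT p z.1 :=
    (measurable_leftEnd hsp p).comp measurable_fst
  have h2 : Measurable fun z : ℝ × ℝ => ENNReal.ofReal (lam p z.1) :=
    ((hlam.measurable p).comp measurable_fst).ennreal_ofReal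
  have h3 : Measurable fun z : ℝ × ℝ => ENNReal.ofReal z.2 := measurable_snd.ennreal_ofReal
  exact (measurableSet_le measurable_const measurable_snd).inter
    ((measurableSet_le h1 h3).inter (measurableSet_lt h3 (h1.add h2)))

lemma pairTo_injective (i : S) : Function.Injective (pairTo i) := by
  intro k l h
  simp only [pairTo, Subtype.mk.injEq, Prod.mk.injEq] at h
  exact Subtype.ext h.2

variable (r lam lamT) in
/-- The set of marks that make a path in state `i` and of age `b` jump. -/
def hitSet (i : S) (b : ℝ) : Set ℝ :=
  ⋃ k : {k : S // k ≠ i}, jumpInterval r lam lamT (pairTo i k) b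

lemma measurableSet_hitSet [Countable S] (i : S) (b : ℝ) :
    MeasurableSet (hitSet r lam lamT i b) :=
  MeasurableSet.iUnion fun _ => measurableSet_jumpInterval _ _

lemma hCoeff_of_mem [IsStrictTotalOrder (Pairs S) r] (hsp : IsSpacing lam lamT) {i : S} {b v : ℝ}
    (hb : 0 ≤ b) {k : {k : S // k ≠ i}} (hv : v ∈ jumpInterval r lam lamT (pairTo i k) b) :
    hCoeff r lam lamT i b v = (k.1 : ℝ) - i := by
  rw [hCoeff, tsum_eq_single k]
  · simp [hv]
  · intro l hl
    have hd := disjoint_jumpInterval (r := r) hsp hb hb (fun _ => rfl)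
      ((pairTo_injective i).ne hl.symm)
    simp [indicator_of_notMem (Set.disjoint_left.1 hd hv)]

lemma hCoeff_of_notMem {i : S} {b v : ℝ} (hv : v ∉ hitSet r lam lamT i b) :
    hCoeff r lam lamT i b v = 0 := by
  rw [hCoeff]
  simp only [hitSet, mem_iUnion, not_exists] at hv
  simp [hv]

lemma gCoeff_of_mem [IsStrictTotalOrder (Pairs S) r] (hsp : IsSpacing lam lamT) {i : S} {b v : ℝ}
    (hb : 0 ≤ b) (hv : v ∈ hitSet r lam lamT i b) :
    gCoeff r lam lamT i b v = b := by
  obtain ⟨k, hk⟩ := mem_iUnion.1 hv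
  rw [gCoeff, tsum_eq_single k]
  · simp [hk]
  · intro l hl
    have hd := disjoint_jumpInterval (r := r) hsp hb hb (fun _ => rfl)
      ((pairTo_injective i).ne hl.symm)
    simp [indicator_of_notMem (Set.disjoint_left.1 hd hk)]

lemma gCoeff_of_notMem {i : S} {b v : ℝ} (hv : v ∉ hitSet r lam lamT i b) :
    gCoeff r lam lamT i b v = 0 := by
  rw [gCoeff]
  simp only [hitSet, mem_iUnion, not_exists] at hv
  simp [hv]

lemma gCoeff_eq_indicator [IsStrictTotalOrder (Pairs S) r] (hsp : IsSpacing lam lamT) {i : S}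
    {b : ℝ} (hb : 0 ≤ b) (v : ℝ) :
    gCoeff r lam lamT i b v = (hitSet r lam lamT i b).indicator (fun _ => b) v := by
  by_cases hv : v ∈ hitSet r lam lamT i b
  · rw [gCoeff_of_mem hsp hb hv, indicator_of_mem hv]
  · rw [gCoeff_of_notMem hv, indicator_of_notMem hv]

end Intervals

/-! ### Solution paths up to the first transition -/

section Paths

variable {S : Set ℝ} {r : Pairs S → Pairs S → Prop} {lam lamT : Pairs S → ℝ → ℝ}
  {μ : Measure (ℝ × ℝ)}

lemma setIntegral_slice_gCoeff [Countable S] [IsStrictTotalOrder (Pairs S) r]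
    (hsp : IsSpacing lam lamT) {i : S} {b : ℝ} (hb : 0 ≤ b) (u : ℝ) :
    ∫ z in {u} ×ˢ univ, gCoeff r lam lamT i b z.2 ∂μ =
      b * μ.real ({u} ×ˢ hitSet r lam lamT i b) := by
  have hm : MeasurableSet ((univ : Set ℝ) ×ˢ hitSet r lam lamT i b) :=
    MeasurableSet.univ.prod (measurableSet_hitSet i b)
  have : ∀ z : ℝ × ℝ, gCoeff r lam lamT i b z.2 =
      ((univ : Set ℝ) ×ˢ hitSet r lam lamT i b).indicator (fun _ => b) z := by
    intro z
    rw [gCoeff_eq_indicator hsp hb]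
    by_cases hz : z.2 ∈ hitSet r lam lamT i b
    · rw [indicator_of_mem hz, indicator_of_mem (show z ∈ univ ×ˢ _ from ⟨trivial, hz⟩)]
    · rw [indicator_of_notMem hz, indicator_of_notMem fun h => hz h.2]
  simp_rw [this]
  rw [setIntegral_indicator hm, setIntegral_const, smul_eq_mul, mul_comm, prod_inter_prod]
  simp

lemma setIntegral_slice_hCoeff [Countable S] [IsStrictTotalOrder (Pairs S) r]
    (hsp : IsSpacing lam lamT) {i : S} {b : ℝ} (hb : 0 ≤ b) {u : ℝ} {k : {k : S // k ≠ i}}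
    (h1 : μ ({u} ×ˢ jumpInterval r lam lamT (pairTo i k) b) = 1)
    (h2 : ∀ l, l ≠ k → μ ({u} ×ˢ jumpInterval r lam lamT (pairTo i l) b) = 0) :
    ∫ z in {u} ×ˢ univ, hCoeff r lam lamT i b z.2 ∂μ = (k.1 : ℝ) - i := by
  have hu : MeasurableSet ({u} ×ˢ univ : Set (ℝ × ℝ)) :=
    (measurableSet_singleton u).prod MeasurableSet.univ
  have hm : MeasurableSet ((univ : Set ℝ) ×ˢ jumpInterval r lam lamT (pairTo i k) b) :=
    MeasurableSet.univ.prod (measurableSet_jumpInterval _ b)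
  have hnull : μ (⋃ l : {l // l ≠ k}, {u} ×ˢ jumpInterval r lam lamT (pairTo i l.1) b) = 0 :=
    measure_iUnion_null fun l => h2 l.1 l.2
  have hae : ∀ᵐ z ∂μ, z ∈ ({u} ×ˢ univ : Set (ℝ × ℝ)) → hCoeff r lam lamT i b z.2 =
      ((univ : Set ℝ) ×ˢ jumpInterval r lam lamT (pairTo i k) b).indicator
        (fun _ => (k.1 : ℝ) - i) z := by
    filter_upwards [measure_eq_zero_iff_ae_notMem.1 hnull] with z hz hzu
    by_cases hk : z.2 ∈ jumpInterval r lam lamT (pairTo i k) b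
    · rw [hCoeff_of_mem hsp hb hk, indicator_of_mem (show z ∈ univ ×ˢ _ from ⟨trivial, hk⟩)]
    · rw [hCoeff_of_notMem, indicator_of_notMem fun h => hk h.2]
      intro h
      obtain ⟨l, hl⟩ := mem_iUnion.1 h
      refine hz (mem_iUnion.2 ⟨⟨l, ?_⟩, hzu.1, hl⟩)
      rintro rfl
      exact hk hl
  rw [setIntegral_congr_ae hu hae, setIntegral_indicator hm, setIntegral_const, smul_eq_mul,
    prod_inter_prod]
  simp [measureReal_def, h1]

namespace IsSolutionPath

variable {i : S} {a : ℝ} {x : ℝ → S} {y : ℝ → ℝ}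

/-- No regularity of the age is assumed. Its left limits come from the integral equation, and its
jump is the part of the integral carried by the slice at `t`. -/
lemma tendsto_age (h : IsSolutionPath r lam lamT μ i a x y) {t : ℝ} (ht : 0 < t) :
    Tendsto y (𝓝[<] t) (𝓝 (Function.leftLim y t)) ∧
      Function.leftLim y t = y t + ∫ z in {t} ×ˢ univ,
        gCoeff r lam lamT (Function.leftLim x t) (Function.leftLim y t) z.2 ∂μ := by
  have h1 : Tendsto y (𝓝[<] t) (𝓝 (y 0 + t - ∫ z in Ioo 0 t ×ˢ univ,
      gCoeff r lam lamT (Function.leftLim x z.1) (Function.leftLim y z.1) z.2 ∂μ)) := by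
    have h2 := ((tendsto_id.mono_left nhdsWithin_le_nhds : Tendsto id (𝓝[<] t) (𝓝 t)).const_add
      (y 0)).sub (tendsto_setIntegral_Ioc_nhdsLT (h.integrable_g t ht))
    refine h2.congr' ?_
    filter_upwards [Ioo_mem_nhdsLT ht] with s hs
    exact (h.age_eq s hs.1).symm
  have h3 := leftLim_eq_of_tendsto h1
  refine ⟨h3 ▸ h1, ?_⟩
  have h4 : ∫ z in {t} ×ˢ univ,
        gCoeff r lam lamT (Function.leftLim x t) (Function.leftLim y t) z.2 ∂μ =
      ∫ z in {t} ×ˢ univ,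
        gCoeff r lam lamT (Function.leftLim x z.1) (Function.leftLim y z.1) z.2 ∂μ := by
    refine setIntegral_congr_fun ((measurableSet_singleton t).prod MeasurableSet.univ) ?_
    rintro z ⟨hz, -⟩
    have : z.1 = t := hz
    simp only [this]
  rw [h4, h.age_eq t ht, setIntegral_Ioc_eq_Ioo_add ht (h.integrable_g t ht)]
  linarith [h3]

lemma state_jump (h : IsSolutionPath r lam lamT μ i a x y) {t : ℝ} (ht : 0 < t) :
    (x t : ℝ) = Function.leftLim x t + ∫ z in {t} ×ˢ univ,
        hCoeff r lam lamT (Function.leftLim x t) (Function.leftLim y t) z.2 ∂μ := by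
  obtain ⟨k, hk⟩ := h.pure_jump.2 t ht
  have hl : Function.leftLim x t = k :=
    leftLim_eq_of_tendsto
      (tendsto_const_nhds.congr' (hk.mono fun s hs => hs.symm))
  have h1 : Tendsto (fun s => (x s : ℝ)) (𝓝[<] t) (𝓝 ((x 0 : ℝ) + ∫ z in Ioo 0 t ×ˢ univ,
      hCoeff r lam lamT (Function.leftLim x z.1) (Function.leftLim y z.1) z.2 ∂μ)) := by
    refine ((tendsto_setIntegral_Ioc_nhdsLT (h.integrable_h t ht)).const_add _).congr' ?_
    filter_upwards [Ioo_mem_nhdsLT ht] with s hs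
    exact (h.state_eq s hs.1).symm
  have h2 : Tendsto (fun s => (x s : ℝ)) (𝓝[<] t) (𝓝 (k : ℝ)) :=
    tendsto_const_nhds.congr' (hk.mono fun s hs => by simp only [hs])
  have h3 := tendsto_nhds_unique h1 h2
  have h4 : ∫ z in {t} ×ˢ univ,
        hCoeff r lam lamT (Function.leftLim x t) (Function.leftLim y t) z.2 ∂μ =
      ∫ z in {t} ×ˢ univ,
        hCoeff r lam lamT (Function.leftLim x z.1) (Function.leftLim y z.1) z.2 ∂μ := by
    refine setIntegral_congr_fun ((measurableSet_singleton t).prod MeasurableSet.univ) ?_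
    rintro z ⟨hz, -⟩
    have : z.1 = t := hz
    simp only [this]
  rw [h4, h.state_eq t ht, setIntegral_Ioc_eq_Ioo_add ht (h.integrable_h t ht), hl]
  linarith [h3]

lemma leftLim_age_nonneg (h : IsSolutionPath r lam lamT μ i a x y) {t : ℝ} (ht : 0 < t) :
    0 ≤ Function.leftLim y t := by
  refine ge_of_tendsto (h.tendsto_age ht).1 ?_
  filter_upwards [Ioo_mem_nhdsLT ht] with s hs
  exact h.age_nonneg s hs.1.le

lemma leftLim_state_eq {t : ℝ} (ht : 0 < t) {k : S} (hx : ∀ u ∈ Ico 0 t, x u = k) :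
    Function.leftLim x t = k := by
  refine leftLim_eq_of_tendsto (tendsto_const_nhds.congr' ?_)
  filter_upwards [Ioo_mem_nhdsLT ht] with s hs
  exact (hx s ⟨hs.1.le, hs.2⟩).symm

/-- As long as the state does not change, no mark is effective. -/
lemma ae_gCoeff_eq_zero [Countable S] [IsStrictTotalOrder (Pairs S) r]
    (hsp : IsSpacing lam lamT) (hμ : IntegerValued μ) (h : IsSolutionPath r lam lamT μ i a x y)
    {s : ℝ} (hx : ∀ u ∈ Icc 0 s, x u = i) :
    ∀ᵐ z ∂μ.restrict (Ioc 0 s ×ˢ univ),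
      gCoeff r lam lamT (Function.leftLim x z.1) (Function.leftLim y z.1) z.2 = 0 := by
  rcases le_or_gt s 0 with hs | hs
  · simp [Ioc_eq_empty (not_lt.2 hs)]
  refine hμ.ae_eq_zero_of_slices (h.integrable_g s hs) fun u hu => ?_
  have hum : MeasurableSet ({u} ×ˢ univ : Set (ℝ × ℝ)) :=
    (measurableSet_singleton u).prod MeasurableSet.univ
  have hlx : Function.leftLim x u = i :=
    leftLim_state_eq hu.1 fun w hw => hx w ⟨hw.1, hw.2.le.trans hu.2⟩
  have hxu : x u = i := hx u ⟨hu.1.le, hu.2⟩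
  have hb := h.leftLim_age_nonneg hu.1
  have hy := (h.tendsto_age hu.1).2
  have hj := h.state_jump hu.1
  have hmeas := fun k : {k : S // k ≠ i} => (measurableSet_singleton u).prod
    (measurableSet_jumpInterval (r := r) (lam := lam) (lamT := lamT) (pairTo i k)
      (Function.leftLim y u))
  have hint : IntegrableOn (fun z : ℝ × ℝ => gCoeff r lam lamT i (Function.leftLim y u) z.2)
      ({u} ×ˢ univ) μ := by
    refine ((h.integrable_g s hs).mono_set
      (prod_mono (singleton_subset_iff.2 hu) subset_rfl)).congr_fun ?_ hum
    rintro z ⟨hz, -⟩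
    have : z.1 = u := hz
    simp only [this, hlx]
  set b := Function.leftLim y u with hbdef
  rw [hlx, setIntegral_slice_gCoeff hsp hb] at hy
  rw [hlx, hxu] at hj
  have hy0 := h.age_nonneg u hu.1.le
  suffices hkey : ∀ᵐ z ∂μ, z ∈ ({u} ×ˢ univ : Set (ℝ × ℝ)) → gCoeff r lam lamT i b z.2 = 0 by
    rw [ae_restrict_iff' hum]
    filter_upwards [hkey] with z hz hzu
    have hz1 : z.1 = u := hzu.1
    simpa only [hz1, hlx] using hz hzu
  -- At age zero the factor `y` in `g` makes the claim trivial; for positive age the effective marks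
  -- in the slice are counted.
  rcases hb.eq_or_lt with hb0 | hb0
  · refine Eventually.of_forall fun z _ => ?_
    simp [← hb0, gCoeff]
  have hUm : MeasurableSet ({u} ×ˢ hitSet r lam lamT i b) :=
    (measurableSet_singleton u).prod (measurableSet_hitSet i b)
  -- Infinite mass has to be excluded separately, since `μ.real` would then be `0` and the age
  -- equation would give no bound.
  have hfin : μ ({u} ×ˢ hitSet r lam lamT i b) ≠ ∞ := by
    have h1 := (hint.measure_norm_ge_lt_top hb0)
    refine ne_top_of_le_ne_top h1.ne ?_
    rw [Measure.restrict_apply' hum]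
    refine measure_mono fun z hz => ⟨?_, hz.1, trivial⟩
    simp [gCoeff_of_mem hsp hb hz.2, abs_of_pos hb0]
  -- With `m` the mass of effective marks, the new age is `b - b m`, and it must be nonnegative.
  have hle : μ ({u} ×ˢ hitSet r lam lamT i b) ≤ 1 := by
    rw [← ENNReal.ofReal_toReal hfin, ← ENNReal.ofReal_one]
    refine ENNReal.ofReal_le_ofReal ?_
    have : b * μ.real ({u} ×ˢ hitSet r lam lamT i b) ≤ b * 1 := by linarith
    exact le_of_mul_le_mul_left this hb0
  -- Mass one would sit on a single interval, of target `k` say, and the state would jump by `k - i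
  -- ≠ 0`.
  have hzero : μ ({u} ×ˢ hitSet r lam lamT i b) = 0 := by
    by_contra hne
    have h1 := hμ.eq_one hUm hne hle
    rw [hitSet, prod_iUnion] at h1
    obtain ⟨k, hk⟩ := hμ.exists_eq_one hmeas h1
    have h2 : ∀ l, l ≠ k → μ ({u} ×ˢ jumpInterval r lam lamT (pairTo i l) b) = 0 := by
      intro l hl
      have hd : Disjoint ({u} ×ˢ jumpInterval r lam lamT (pairTo i k) b)
          ({u} ×ˢ jumpInterval r lam lamT (pairTo i l) b) :=
        Set.disjoint_prod.2 (Or.inr (disjoint_jumpInterval hsp hb hb (fun _ => rfl)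
          ((pairTo_injective i).ne hl.symm)))
      have h3 := measure_union (μ := μ) hd (hmeas l)
      have h4 : μ ({u} ×ˢ jumpInterval r lam lamT (pairTo i k) b ∪
          {u} ×ˢ jumpInterval r lam lamT (pairTo i l) b) ≤ 1 := by
        rw [← h1]
        exact measure_mono (union_subset (subset_iUnion (fun k : {k : S // k ≠ i} =>
          ({u} : Set ℝ) ×ˢ jumpInterval r lam lamT (pairTo i k) b) k)
          (subset_iUnion (fun k : {k : S // k ≠ i} =>
          ({u} : Set ℝ) ×ˢ jumpInterval r lam lamT (pairTo i k) b) l))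
      rw [h3, hk] at h4
      by_contra h5
      have h6 := hμ.one_le (hmeas l) h5
      have : (1 : ℝ≥0∞) + 1 ≤ 1 := le_trans (by gcongr) h4
      norm_num at this
    rw [setIntegral_slice_hCoeff hsp hb hk h2] at hj
    exact k.2 (Subtype.ext (by linarith))
  filter_upwards [measure_eq_zero_iff_ae_notMem.1 hzero] with z hz hzu
  exact gCoeff_of_notMem fun hv => hz ⟨hzu.1, hv⟩

lemma age_eq_of_const [Countable S] [IsStrictTotalOrder (Pairs S) r]
    (hsp : IsSpacing lam lamT) (hμ : IntegerValued μ) (h : IsSolutionPath r lam lamT μ i a x y)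
    {s : ℝ} (hs : 0 ≤ s) (hx : ∀ u ∈ Icc 0 s, x u = i) : y s = a + s := by
  rcases hs.eq_or_lt with rfl | hs
  · simp [h.init_age]
  rw [h.age_eq s hs, integral_eq_zero_of_ae (h.ae_gCoeff_eq_zero hsp hμ hx), h.init_age, sub_zero]

lemma leftLim_age_eq [Countable S] [IsStrictTotalOrder (Pairs S) r]
    (hsp : IsSpacing lam lamT) (hμ : IntegerValued μ) (h : IsSolutionPath r lam lamT μ i a x y)
    {s : ℝ} (hs : 0 < s) (hx : ∀ u ∈ Ico 0 s, x u = i) : Function.leftLim y s = a + s := by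
  refine leftLim_eq_of_tendsto ?_
  have h1 : Tendsto (fun u => a + u) (𝓝[<] s) (𝓝 (a + s)) :=
    (tendsto_id.mono_left nhdsWithin_le_nhds : Tendsto id (𝓝[<] s) (𝓝 s)).const_add a
  refine h1.congr' ?_
  filter_upwards [Ioo_mem_nhdsLT hs] with u hu
  exact (h.age_eq_of_const hsp hμ hu.1.le fun w hw => hx w ⟨hw.1, hw.2.trans_lt hu.2⟩).symm

/-- A path that leaves its initial state does so at a first time, at which one of the marks is
effective. -/
lemma exists_first_transition [Countable S] [IsStrictTotalOrder (Pairs S) r]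
    (hsp : IsSpacing lam lamT) (hμ : IntegerValued μ) (h : IsSolutionPath r lam lamT μ i a x y)
    {s : ℝ} (hx : ¬ ∀ u ∈ Icc 0 s, x u = i) :
    ∃ T ∈ Ioc 0 s, (∀ u ∈ Ico 0 T, x u = i) ∧ x T ≠ i ∧
      μ ({T} ×ˢ hitSet r lam lamT i (a + T)) ≠ 0 := by
  push Not at hx
  obtain ⟨w, hw, hxw⟩ := hx
  set K : Set ℝ := {u | 0 ≤ u ∧ x u ≠ i} with hK
  have hbdd : BddBelow K := ⟨0, fun u hu => hu.1⟩
  have hwK : w ∈ K := ⟨hw.1, hxw⟩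
  have hT0 : 0 ≤ sInf K := le_csInf ⟨w, hwK⟩ fun u hu => hu.1
  -- Right continuity for the discrete topology makes the infimum a time at which the state has
  -- already changed.
  have hTi : x (sInf K) ≠ i := by
    intro hxT
    obtain ⟨b, hb, hb'⟩ := mem_nhdsGT_iff_exists_Ioo_subset.1 (h.pure_jump.1 (sInf K) hT0)
    obtain ⟨u, hu, hub⟩ := exists_lt_of_csInf_lt ⟨w, hwK⟩ hb
    rcases (csInf_le hbdd hu).eq_or_lt with h1 | h1
    · exact hu.2 (h1 ▸ hxT)
    · exact hu.2 ((hb' ⟨h1, hub⟩ : x u = x (sInf K)).trans hxT)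
  have hTpos : 0 < sInf K := by
    refine hT0.lt_of_ne fun h0 => hTi ?_
    rw [← h0, h.init_state]
  have hbefore : ∀ u ∈ Ico 0 (sInf K), x u = i := by
    intro u hu
    by_contra hne
    exact (csInf_le hbdd (show u ∈ K from ⟨hu.1, hne⟩)).not_gt hu.2
  refine ⟨sInf K, ⟨hTpos, (csInf_le hbdd hwK).trans hw.2⟩, hbefore, hTi, fun h0 => hTi ?_⟩
  have hj := h.state_jump hTpos
  rw [leftLim_state_eq hTpos hbefore, h.leftLim_age_eq hsp hμ hTpos hbefore] at hj
  have hzero : ∫ z in {sInf K} ×ˢ univ, hCoeff r lam lamT i (a + sInf K) z.2 ∂μ = 0 := by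
    refine integral_eq_zero_of_ae ((ae_restrict_iff'
      ((measurableSet_singleton _).prod MeasurableSet.univ)).2 ?_)
    filter_upwards [measure_eq_zero_iff_ae_notMem.1 h0] with z hz hzu
    exact hCoeff_of_notMem fun hv => hz ⟨hzu.1, hv⟩
  rw [hzero, add_zero] at hj
  exact Subtype.ext hj

end IsSolutionPath

variable (r lam lamT) in
/-- The space-time points which trigger the transition `p` of a path of initial age `a`. -/
def trigger (p : Pairs S) (a : ℝ) : Set (ℝ × ℝ) :=
  {z | 0 < z.1 ∧ z.2 ∈ jumpInterval r lam lamT p (a + z.1)}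

lemma measurableSet_trigger [Countable S] (hlam : IsRateMatrix lam)
    (hsp : IsSpacing lam lamT) (p : Pairs S) (a : ℝ) :
    MeasurableSet (trigger r lam lamT p a) := by
  have hm : Measurable fun z : ℝ × ℝ => (a + z.1, z.2) := by fun_prop
  exact (measurableSet_lt measurable_const measurable_fst).inter
    (hm (measurableSet_jumpInterval_joint hlam hsp p))

lemma slice_subset_trigger {p : Pairs S} {a s T : ℝ} (hT : T ∈ Ioc 0 s) :
    {T} ×ˢ jumpInterval r lam lamT p (a + T) ⊆ trigger r lam lamT p a ∩ Ioc 0 s ×ˢ univ := by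
  rintro z ⟨hz, hz2⟩
  have hz1 : z.1 = T := hz
  refine ⟨⟨?_, ?_⟩, ?_, trivial⟩
  · rw [hz1]; exact hT.1
  · rw [hz1]; exact hz2
  · rw [hz1]; exact hT

namespace IsSolutionPath

variable {i : S} {a : ℝ} {x : ℝ → S} {y : ℝ → ℝ}

lemma const_of_trigger_null [Countable S] [IsStrictTotalOrder (Pairs S) r]
    (hsp : IsSpacing lam lamT) (hμ : IntegerValued μ) (h : IsSolutionPath r lam lamT μ i a x y)
    {s : ℝ} (h0 : ∀ k, μ (trigger r lam lamT (pairTo i k) a ∩ Ioc 0 s ×ˢ univ) = 0) :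
    ∀ u ∈ Icc 0 s, x u = i := by
  by_contra hx
  obtain ⟨T, hT, -, -, hne⟩ := h.exists_first_transition hsp hμ hx
  refine hne ?_
  rw [hitSet, prod_iUnion]
  exact measure_iUnion_null fun k => measure_mono_null (slice_subset_trigger hT) (h0 k)

/-- If exactly one mark is effective up to time `s`, then the path has a first transition, to the
corresponding state. -/
lemma exists_transition_to [Countable S] [IsStrictTotalOrder (Pairs S) r]
    (hsp : IsSpacing lam lamT) (hμ : IntegerValued μ)
    (h : IsSolutionPath r lam lamT μ i a x y) (ha : 0 ≤ a) {s : ℝ} {k : {k : S // k ≠ i}}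
    (h1 : μ (trigger r lam lamT (pairTo i k) a ∩ Ioc 0 s ×ˢ univ) = 1)
    (h0 : ∀ l, l ≠ k → μ (trigger r lam lamT (pairTo i l) a ∩ Ioc 0 s ×ˢ univ) = 0) :
    ∃ T ∈ Ioc 0 s, (∀ u ∈ Ico 0 T, x u = i) ∧ x T = k.1 ∧ y T = 0 := by
  -- If the state stayed at `i`, then `g` would vanish almost everywhere, whereas on the trigger set
  -- it equals the age `a + u > 0`.
  have hx : ¬ ∀ u ∈ Icc 0 s, x u = i := by
    intro hx
    have hg := h.ae_gCoeff_eq_zero hsp hμ hx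
    rw [ae_restrict_iff' (measurableSet_Ioc.prod MeasurableSet.univ)] at hg
    have hnull : μ (trigger r lam lamT (pairTo i k) a ∩ Ioc 0 s ×ˢ univ) = 0 := by
      rw [measure_eq_zero_iff_ae_notMem]
      filter_upwards [hg] with z hz hzt
      have hpos : 0 < z.1 := hzt.1.1
      have hco : ∀ u ∈ Ico 0 z.1, x u = i := fun u hu => hx u ⟨hu.1, hu.2.le.trans hzt.2.1.2⟩
      have h2 := hz hzt.2
      rw [leftLim_state_eq hpos hco, h.leftLim_age_eq hsp hμ hpos hco,
        gCoeff_of_mem hsp (by linarith) (mem_iUnion.2 ⟨k, hzt.1.2⟩)] at h2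
      linarith
    simp [hnull] at h1
  obtain ⟨T, hT, hbefore, -, hne⟩ := h.exists_first_transition hsp hμ hx
  have hb : 0 ≤ a + T := by linarith [hT.1]
  have h2 : ∀ l, l ≠ k → μ ({T} ×ˢ jumpInterval r lam lamT (pairTo i l) (a + T)) = 0 :=
    fun l hl => measure_mono_null (slice_subset_trigger hT) (h0 l hl)
  have hsplit : ({T} : Set ℝ) ×ˢ hitSet r lam lamT i (a + T) ⊆
      {T} ×ˢ jumpInterval r lam lamT (pairTo i k) (a + T) ∪
        ⋃ l : {l // l ≠ k}, {T} ×ˢ jumpInterval r lam lamT (pairTo i l.1) (a + T) := by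
    rintro z ⟨hz, hv⟩
    obtain ⟨l, hl⟩ := mem_iUnion.1 hv
    by_cases hlk : l = k
    · exact Or.inl ⟨hz, hlk ▸ hl⟩
    · exact Or.inr (mem_iUnion.2 ⟨⟨l, hlk⟩, hz, hl⟩)
  have hnull : μ (⋃ l : {l // l ≠ k},
      {T} ×ˢ jumpInterval r lam lamT (pairTo i l.1) (a + T)) = 0 :=
    measure_iUnion_null fun l => h2 l.1 l.2
  have hk0 : μ ({T} ×ˢ jumpInterval r lam lamT (pairTo i k) (a + T)) ≠ 0 := fun h3 =>
    hne (measure_mono_null hsplit (measure_union_null h3 hnull))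
  have hk : μ ({T} ×ˢ jumpInterval r lam lamT (pairTo i k) (a + T)) = 1 :=
    hμ.eq_one ((measurableSet_singleton T).prod (measurableSet_jumpInterval _ _)) hk0
      (h1 ▸ measure_mono (slice_subset_trigger hT))
  have hhit : μ ({T} ×ˢ hitSet r lam lamT i (a + T)) = 1 := by
    refine le_antisymm ?_ ?_
    · refine (measure_mono hsplit).trans ((measure_union_le _ _).trans ?_)
      rw [hnull, hk, add_zero]
    · rw [← hk]
      exact measure_mono (prod_mono subset_rfl
        (subset_iUnion (fun k => jumpInterval r lam lamT (pairTo i k) (a + T)) k))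
  refine ⟨T, hT, hbefore, Subtype.ext ?_, ?_⟩
  · have hj := h.state_jump hT.1
    rw [leftLim_state_eq hT.1 hbefore, h.leftLim_age_eq hsp hμ hT.1 hbefore,
      setIntegral_slice_hCoeff hsp hb hk h2] at hj
    linarith
  -- A single effective mark subtracts the whole age `a + T`, so the age restarts at zero.
  · have hy := (h.tendsto_age hT.1).2
    rw [leftLim_state_eq hT.1 hbefore, h.leftLim_age_eq hsp hμ hT.1 hbefore,
      setIntegral_slice_gCoeff hsp hb, measureReal_def, hhit] at hy
    simpa using hy

end IsSolutionPath

lemma collectiveTime_one_comm (x₁ x₂ : ℝ → S) :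
    collectiveTime x₁ x₂ 1 = collectiveTime x₂ x₁ 1 := by
  simp [collectiveTime, or_comm]

lemma collectiveTime_one_eq {x₁ x₂ : ℝ → S} {i j : S} {T : ℝ} (hT : 0 < T)
    (h₁ : ∀ u ∈ Ico 0 T, x₁ u = i) (hne : x₁ T ≠ i) (h₂ : ∀ u ∈ Icc 0 T, x₂ u = j) :
    collectiveTime x₁ x₂ 1 = (T : EReal) := by
  rw [collectiveTime]
  refine IsLeast.csInf_eq ⟨⟨?_, T, Or.inl ⟨hT, ?_⟩, rfl⟩, ?_⟩
  · simpa [collectiveTime] using hT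
  · rw [IsSolutionPath.leftLim_state_eq hT h₁]
    exact hne.symm
  · rintro _ ⟨-, s, hs, rfl⟩
    refine EReal.coe_le_coe_iff.2 ?_
    by_contra! hlt
    rcases hs with ⟨hs0, hs⟩ | ⟨hs0, hs⟩
    · refine hs ?_
      rw [h₁ s ⟨hs0.le, hlt⟩]
      exact IsSolutionPath.leftLim_state_eq hs0 fun u hu => h₁ u ⟨hu.1, hu.2.trans hlt⟩
    · refine hs ?_
      rw [h₂ s ⟨hs0.le, hlt.le⟩]
      exact IsSolutionPath.leftLim_state_eq hs0 fun u hu => h₂ u ⟨hu.1, (hu.2.trans hlt).le⟩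

/-- If exactly one mark is effective for the two paths up to time `s`, and acts on the first path,
then the paths meet at the first collective transition exactly if this mark moves the first path to
the state of the second one. -/
lemma meets_iff_of_transition [Countable S] [IsStrictTotalOrder (Pairs S) r]
    (hsp : IsSpacing lam lamT) (hμ : IntegerValued μ) {i j : S} {a₁ a₂ : ℝ} {x₁ x₂ : ℝ → S}
    {y₁ y₂ : ℝ → ℝ} (h₁ : IsSolutionPath r lam lamT μ i a₁ x₁ y₁)
    (h₂ : IsSolutionPath r lam lamT μ j a₂ x₂ y₂) (ha₁ : 0 ≤ a₁)
    {s : ℝ} {k : {k : S // k ≠ i}}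
    (hk : μ (trigger r lam lamT (pairTo i k) a₁ ∩ Ioc 0 s ×ˢ univ) = 1)
    (hl : ∀ l, l ≠ k → μ (trigger r lam lamT (pairTo i l) a₁ ∩ Ioc 0 s ×ˢ univ) = 0)
    (hj : ∀ l, μ (trigger r lam lamT (pairTo j l) a₂ ∩ Ioc 0 s ×ˢ univ) = 0) :
    (∃ T : ℝ, collectiveTime x₁ x₂ 1 = (T : EReal) ∧ x₁ T = x₂ T ∧ min (y₁ T) (y₂ T) = 0) ↔
      k.1 = j := by
  obtain ⟨T, hT, hbefore, hxT, hyT⟩ := h₁.exists_transition_to hsp hμ ha₁ hk hl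
  have hx₂ := h₂.const_of_trigger_null hsp hμ hj
  have hct := collectiveTime_one_eq (x₂ := x₂) (j := j) hT.1 hbefore (hxT ▸ k.2)
    fun u hu => hx₂ u ⟨hu.1, hu.2.trans hT.2⟩
  have hx₂T : x₂ T = j := hx₂ T ⟨hT.1.le, hT.2⟩
  constructor
  · rintro ⟨T', h1, h2, -⟩
    rw [hct] at h1
    obtain rfl := EReal.coe_injective h1
    rw [← hxT, h2, hx₂T]
  · intro hkj
    refine ⟨T, hct, by rw [hxT, hx₂T, hkj], ?_⟩
    rw [hyT]
    exact min_eq_left (h₂.age_nonneg T hT.1.le)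

end Paths

/-! ### The first point of a Poisson random measure in one of two disjoint regions -/

section Poisson

variable {Ω E : Type*} [MeasurableSpace Ω] [MeasurableSpace E] {P : Measure Ω}
  {N : Ω → Measure E} {ν : Measure E}

namespace IsPoissonRandomMeasure

lemma measure_eq_natCast (hN : IsPoissonRandomMeasure P N ν) {A : Set E} (hA : MeasurableSet A)
    (hfin : ν A ≠ ∞) (n : ℕ) :
    P {ω | N ω A = n} =
      ENNReal.ofReal (Real.exp (-(ν A).toReal) * (ν A).toReal ^ n / n.factorial) := by
  have h1 : P {ω | N ω A = n} = P.map (fun ω => N ω A) {(n : ℝ≥0∞)} := by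
    rw [Measure.map_apply (hN.measurable A hA) (measurableSet_singleton _)]
    rfl
  have h2 : (fun n : ℕ => (n : ℝ≥0∞)) ⁻¹' {(n : ℝ≥0∞)} = {n} := by
    ext m; simp
  rw [h1, hN.poisson A hA hfin, Measure.map_apply (measurable_of_countable _)
    (measurableSet_singleton _), h2, poissonMeasure_singleton]
  rfl

lemma ae_eq_zero (hN : IsPoissonRandomMeasure P N ν) [IsProbabilityMeasure P] {A : Set E}
    (hA : MeasurableSet A) (h0 : ν A = 0) : ∀ᵐ ω ∂P, N ω A = 0 := by
  have h1 := hN.measure_eq_natCast hA (by simp [h0]) 0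
  simp only [h0, ENNReal.toReal_zero, neg_zero, Real.exp_zero, pow_zero, Nat.factorial_zero,
    Nat.cast_one, Nat.cast_zero, mul_one, div_one, ENNReal.ofReal_one] at h1
  exact (mem_ae_iff_prob_eq_one (hN.measurable A hA (measurableSet_singleton 0))).2 h1

/-- The probability that exactly the second one of three disjoint sets is charged, once. -/
lemma measure_only_second (hN : IsPoissonRandomMeasure P N ν) {A B C : Set E}
    (hA : MeasurableSet A) (hB : MeasurableSet B) (hC : MeasurableSet C) (hAB : Disjoint A B)
    (hAC : Disjoint A C) (hBC : Disjoint B C) (hfA : ν A ≠ ∞) (hfB : ν B ≠ ∞) (hfC : ν C ≠ ∞) :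
    P {ω | N ω A = 0 ∧ N ω B = 1 ∧ N ω C = 0} =
      ENNReal.ofReal (Real.exp (-(ν A + (ν B + ν C)).toReal)) * ν B := by
  have hind := hN.indep 3 ![A, B, C] (by
    intro k; fin_cases k <;> simpa) (by
    intro k l hkl
    fin_cases k <;> fin_cases l <;> simp_all [disjoint_comm])
  have h := hind.measure_inter_preimage_eq_mul Finset.univ (sets := ![{0}, {1}, {0}])
    (by intro k _; fin_cases k <;> simp)
  have hset : {ω | N ω A = 0 ∧ N ω B = 1 ∧ N ω C = 0} = ⋂ k ∈ Finset.univ,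
      (fun ω => N ω ((![A, B, C] : Fin 3 → Set E) k)) ⁻¹' ((![{0}, {1}, {0}] :
        Fin 3 → Set ℝ≥0∞) k) := by
    ext ω
    simp [Fin.forall_fin_succ]
  rw [hset, h, Fin.prod_univ_three]
  have e1 := hN.measure_eq_natCast hA hfA 0
  have e2 := hN.measure_eq_natCast hB hfB 1
  have e3 := hN.measure_eq_natCast hC hfC 0
  simp only [Nat.cast_zero, Nat.cast_one, pow_zero, pow_one, Nat.factorial, mul_one,
    div_one] at e1 e2 e3
  change P {ω | N ω A = 0} * P {ω | N ω B = 1} * P {ω | N ω C = 0} = _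
  rw [e1, e2, e3, ENNReal.toReal_add hfA (by finiteness), ENNReal.toReal_add hfB hfC]
  nth_rewrite 4 [← ENNReal.ofReal_toReal hfB]
  rw [← ENNReal.ofReal_mul (by positivity), ← ENNReal.ofReal_mul (by positivity),
    ← ENNReal.ofReal_mul (by positivity)]
  congr 1
  rw [neg_add, neg_add, Real.exp_add, Real.exp_add]
  ring

end IsPoissonRandomMeasure

end Poisson

/-! ### Cumulative densities and the total mass of `e^{-∫R} R` -/

/-- The mass on `(0,u]` of a density. -/
def cumulative (R : ℝ → ℝ≥0∞) (u : ℝ) : ℝ := (∫⁻ t in Ioc 0 u, R t).toReal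

section Cumulative

variable {R : ℝ → ℝ≥0∞} {c : ℝ≥0}

lemma lintegral_Ioc_le (hc : ∀ᵐ u ∂volume.restrict (Ioi (0 : ℝ)), R u ≤ c) {s t : ℝ}
    (hs : 0 ≤ s) : ∫⁻ u in Ioc s t, R u ≤ c * ENNReal.ofReal (t - s) := by
  have h : ∀ᵐ u ∂volume.restrict (Ioc s t), R u ≤ c :=
    ae_mono (Measure.restrict_mono (fun u hu => hs.trans_lt hu.1) le_rfl) hc
  refine (lintegral_mono_ae h).trans ?_
  simp

lemma lintegral_Ioc_ne_top (hc : ∀ᵐ u ∂volume.restrict (Ioi (0 : ℝ)), R u ≤ c) {s t : ℝ}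
    (hs : 0 ≤ s) : ∫⁻ u in Ioc s t, R u ≠ ∞ :=
  ne_top_of_le_ne_top (by finiteness) (lintegral_Ioc_le hc hs)

lemma cumulative_add (hc : ∀ᵐ u ∂volume.restrict (Ioi (0 : ℝ)), R u ≤ c) {s t : ℝ}
    (hs : 0 ≤ s) (hst : s ≤ t) :
    cumulative R t = cumulative R s + (∫⁻ u in Ioc s t, R u).toReal := by
  rw [cumulative, cumulative, ← ENNReal.toReal_add (lintegral_Ioc_ne_top hc le_rfl)
    (lintegral_Ioc_ne_top hc hs), ← Ioc_union_Ioc_eq_Ioc hs hst,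
    lintegral_union measurableSet_Ioc]
  rw [Set.disjoint_left]
  intro u h1 h2
  exact h1.2.not_gt h2.1

lemma cumulative_le_cumulative (hc : ∀ᵐ u ∂volume.restrict (Ioi (0 : ℝ)), R u ≤ c) {s t : ℝ}
    (hs : 0 ≤ s) (hst : s ≤ t) : cumulative R s ≤ cumulative R t := by
  rw [cumulative_add hc hs hst]
  exact le_add_of_nonneg_right ENNReal.toReal_nonneg

lemma cumulative_le_add (hc : ∀ᵐ u ∂volume.restrict (Ioi (0 : ℝ)), R u ≤ c) {s t : ℝ}
    (hs : 0 ≤ s) (hst : s ≤ t) : cumulative R t ≤ cumulative R s + c * (t - s) := by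
  rw [cumulative_add hc hs hst]
  gcongr
  refine ENNReal.toReal_le_of_le_ofReal (by have := sub_nonneg.2 hst; positivity) ?_
  refine (lintegral_Ioc_le hc hs).trans_eq ?_
  rw [ENNReal.ofReal_mul (NNReal.coe_nonneg c)]
  simp

lemma measurable_cumulative (hc : ∀ᵐ u ∂volume.restrict (Ioi (0 : ℝ)), R u ≤ c) :
    Measurable (cumulative R) := by
  have hmono : Monotone (cumulative R) := by
    intro s t hst
    refine ENNReal.toReal_mono (lintegral_Ioc_ne_top hc le_rfl) ?_
    exact lintegral_mono_set (Ioc_subset_Ioc_right hst)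
  exact hmono.measurable

lemma iUnion_Ioc_natCast_mul {δ : ℝ} (hδ : 0 < δ) :
    ⋃ k : ℕ, Ioc (δ * k) (δ * (k + 1)) = Ioi 0 := by
  ext u
  simp only [mem_iUnion, mem_Ioc, mem_Ioi]
  constructor
  · rintro ⟨k, hk, -⟩
    exact lt_of_le_of_lt (by positivity) hk
  · intro hu
    have hpos : 0 < ⌈u / δ⌉₊ := Nat.ceil_pos.2 (by positivity)
    refine ⟨⌈u / δ⌉₊ - 1, ?_, ?_⟩
    · have : ⌈u / δ⌉₊ - 1 < ⌈u / δ⌉₊ := by omega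
      rw [mul_comm, ← lt_div_iff₀ hδ]
      exact Nat.lt_ceil.1 this
    · have h1 : ((⌈u / δ⌉₊ - 1 : ℕ) : ℝ) + 1 = ⌈u / δ⌉₊ := by
        rw [Nat.cast_sub hpos]; simp
      rw [h1, mul_comm, ← div_le_iff₀ hδ]
      exact Nat.le_ceil _

lemma pairwise_disjoint_Ioc_natCast_mul {δ : ℝ} (hδ : 0 < δ) :
    Pairwise (Function.onFun Disjoint fun k : ℕ => Ioc (δ * k) (δ * (k + 1))) := by
  have hm : Monotone fun k : ℕ => δ * k := by
    intro k l hkl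
    simp only
    gcongr
  have := hm.pairwise_disjoint_on_Ioc_succ
  simpa [Nat.succ_eq_succ] using this

lemma lintegral_Ioi_eq_tsum (f : ℝ → ℝ≥0∞) {δ : ℝ} (hδ : 0 < δ) :
    ∫⁻ u in Ioi 0, f u = ∑' k : ℕ, ∫⁻ u in Ioc (δ * k) (δ * (k + 1)), f u := by
  rw [← iUnion_Ioc_natCast_mul hδ, lintegral_iUnion (fun _ => measurableSet_Ioc)
    (pairwise_disjoint_Ioc_natCast_mul hδ)]

/-- Removes the discretization error: estimates on a grid of mesh `δ` lose a factor `e^{-cδ}`, which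
tends to one. -/
lemma le_of_forall_exp_mul_le {x : ℝ≥0∞} {y : ℝ≥0∞} (c : ℝ)
    (h : ∀ n : ℕ, ENNReal.ofReal (Real.exp (-(c * (1 / ((n : ℝ) + 1))))) * x ≤ y) : x ≤ y := by
  have h1 : Tendsto (fun n : ℕ => ENNReal.ofReal (Real.exp (-(c * (1 / ((n : ℝ) + 1)))))) atTop
      (𝓝 1) := by
    rw [← ENNReal.ofReal_one]
    refine ENNReal.tendsto_ofReal ?_
    have h2 := ((tendsto_one_div_add_atTop_nhds_zero_nat (𝕜 := ℝ)).const_mul c).neg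
    rw [mul_zero, neg_zero] at h2
    simpa [Function.comp_def] using (Real.continuous_exp.tendsto 0).comp h2
  have h3 := ENNReal.Tendsto.mul_const (b := x) h1 (Or.inl one_ne_zero)
  rw [one_mul] at h3
  exact le_of_tendsto h3 (Eventually.of_forall h)

/-- The density `e^{-∫R} R` has total mass at least one if `∫ R = ∞`. -/
lemma one_le_lintegral_exp_neg_cumulative
    (hc : ∀ᵐ u ∂volume.restrict (Ioi (0 : ℝ)), R u ≤ c)
    (htop : Tendsto (cumulative R) atTop atTop) :
    1 ≤ ∫⁻ u in Ioi 0, ENNReal.ofReal (Real.exp (-cumulative R u)) * R u := by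
  refine le_of_forall_exp_mul_le c fun n => ?_
  set δ : ℝ := 1 / ((n : ℝ) + 1) with hδdef
  have hδ : 0 < δ := by positivity
  set L := cumulative R with hL
  -- Discrete substitute for `(e^{-L})' = -e^{-L} R`, avoiding differentiation of `L`: on a cell,
  -- `L` grows by at most `cδ`, and `1 - e^{-x} ≤ x` with `x` the increment of `L`.
  have hslab : ∀ k : ℕ, ENNReal.ofReal (Real.exp (-(c * δ)) *
      (Real.exp (-L (δ * k)) - Real.exp (-L (δ * (k + 1))))) ≤
      ∫⁻ u in Ioc (δ * k) (δ * (k + 1)), ENNReal.ofReal (Real.exp (-L u)) * R u := by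
    intro k
    have hs : 0 ≤ δ * k := by positivity
    have hst : δ * k ≤ δ * (k + 1) := by gcongr; linarith
    have h1 : ENNReal.ofReal (Real.exp (-L (δ * (k + 1)))) *
        ∫⁻ u in Ioc (δ * k) (δ * (k + 1)), R u ≤
        ∫⁻ u in Ioc (δ * k) (δ * (k + 1)), ENNReal.ofReal (Real.exp (-L u)) * R u := by
      rw [← lintegral_const_mul' _ _ ENNReal.ofReal_ne_top]
      refine setLIntegral_mono' measurableSet_Ioc fun u hu => ?_
      gcongr
      exact cumulative_le_cumulative hc (hs.trans hu.1.le) hu.2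
    refine le_trans ?_ h1
    have h2 := cumulative_add hc hs hst
    have h3 := cumulative_le_add hc hs hst
    rw [← ENNReal.ofReal_toReal (lintegral_Ioc_ne_top hc hs),
      ← ENNReal.ofReal_mul (Real.exp_nonneg _)]
    refine ENNReal.ofReal_le_ofReal ?_
    rw [← hL] at h2 h3
    have h4 : (∫⁻ u in Ioc (δ * k) (δ * (k + 1)), R u).toReal =
        L (δ * (k + 1)) - L (δ * k) := by linarith
    rw [h4]
    have h5 : Real.exp (-(c * δ)) * Real.exp (-L (δ * k)) ≤ Real.exp (-L (δ * (k + 1))) := by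
      rw [← Real.exp_add]
      refine Real.exp_le_exp.2 ?_
      have : (c : ℝ) * (δ * (k + 1) - δ * k) = c * δ := by ring
      linarith
    have h6 : Real.exp (-L (δ * k)) - Real.exp (-L (δ * (k + 1))) ≤
        Real.exp (-L (δ * k)) * (L (δ * (k + 1)) - L (δ * k)) := by
      have h7 := Real.add_one_le_exp (-(L (δ * (k + 1)) - L (δ * k)))
      have h8 : Real.exp (-L (δ * (k + 1))) =
          Real.exp (-L (δ * k)) * Real.exp (-(L (δ * (k + 1)) - L (δ * k))) := by
        rw [← Real.exp_add]; congr 1; ring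
      rw [h8]
      have h9 := Real.exp_pos (-L (δ * k))
      nlinarith
    have h10 : 0 ≤ L (δ * (k + 1)) - L (δ * k) :=
      sub_nonneg.2 (cumulative_le_cumulative hc hs hst)
    calc _ ≤ Real.exp (-(c * δ)) * (Real.exp (-L (δ * k)) * (L (δ * (k + 1)) - L (δ * k))) := by
          gcongr
      _ = Real.exp (-(c * δ)) * Real.exp (-L (δ * k)) * (L (δ * (k + 1)) - L (δ * k)) := by ring
      _ ≤ _ := by gcongr
  -- The cell bounds telescope; letting `K → ∞` uses `L → ∞`.
  have hpart : ∀ K : ℕ, ENNReal.ofReal (Real.exp (-(c * δ)) * (1 - Real.exp (-L (δ * K)))) ≤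
      ∫⁻ u in Ioi 0, ENNReal.ofReal (Real.exp (-L u)) * R u := by
    intro K
    have h0 : L 0 = 0 := by simp [hL, cumulative]
    have htel := Finset.sum_range_sub' (fun k : ℕ => Real.exp (-L (δ * k))) K
    simp only [Nat.cast_zero, mul_zero, h0, neg_zero, Real.exp_zero, Nat.cast_add,
      Nat.cast_one] at htel
    rw [← htel, Finset.mul_sum, ENNReal.ofReal_sum_of_nonneg, lintegral_Ioi_eq_tsum _ hδ]
    · exact (Finset.sum_le_sum fun k _ => hslab k).trans (ENNReal.sum_le_tsum _)
    · intro k _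
      refine mul_nonneg (Real.exp_nonneg _) (sub_nonneg.2 (Real.exp_le_exp.2 (neg_le_neg ?_)))
      exact cumulative_le_cumulative hc (by positivity) (by gcongr; linarith)
  rw [mul_one]
  have hlim : Tendsto (fun K : ℕ => ENNReal.ofReal
      (Real.exp (-(c * δ)) * (1 - Real.exp (-L (δ * K))))) atTop
      (𝓝 (ENNReal.ofReal (Real.exp (-(c * δ))))) := by
    refine ENNReal.tendsto_ofReal ?_
    have h1 : Tendsto (fun K : ℕ => Real.exp (-L (δ * K))) atTop (𝓝 0) :=
      Real.tendsto_exp_neg_atTop_nhds_zero.comp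
        (htop.comp (tendsto_natCast_atTop_atTop.const_mul_atTop hδ))
    simpa using (h1.const_sub 1).const_mul (Real.exp (-(c * δ)))
  exact le_of_tendsto hlim (Eventually.of_forall hpart)

end Cumulative

/-! ### Grid events for the first point and their probabilities -/

/-- The region `C` has, with respect to time, the density `R` under `ν`. -/
structure HasTimeDensity (ν : Measure (ℝ × ℝ)) (C : Set (ℝ × ℝ)) (R : ℝ → ℝ≥0∞) : Prop where
  measurableSet : MeasurableSet C
  measurable : Measurable R
  measure_eq : ∀ s t, 0 ≤ s → ν (C ∩ Ioc s t ×ˢ univ) = ∫⁻ u in Ioc s t, R u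

/-- The event that the points in `C ∪ D` up to time `t` are a single point of `C`, whose time is
after `s`. -/
def firstPointIn {Ω : Type*} (N : Ω → Measure (ℝ × ℝ)) (C D : Set (ℝ × ℝ)) (s t : ℝ) : Set Ω :=
  {ω | N ω ((C ∪ D) ∩ Ioc 0 s ×ˢ univ) = 0 ∧ N ω (C ∩ Ioc s t ×ˢ univ) = 1 ∧
    N ω (D ∩ Ioc s t ×ˢ univ) = 0}

/-- The union of the events `firstPointIn` over the intervals of the grids of mesh `1 / (n + 1)`. -/
def firstPointInGrid {Ω : Type*} (N : Ω → Measure (ℝ × ℝ)) (C D : Set (ℝ × ℝ)) : Set Ω :=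
  ⋃ n : ℕ, ⋃ k : ℕ, firstPointIn N C D (1 / ((n : ℝ) + 1) * k) (1 / ((n : ℝ) + 1) * (k + 1))

section FirstPoint

variable {Ω : Type*} [MeasurableSpace Ω] {P : Measure Ω} {N : Ω → Measure (ℝ × ℝ)}
  {ν : Measure (ℝ × ℝ)} {C D : Set (ℝ × ℝ)} {R R' : ℝ → ℝ≥0∞} {c : ℝ≥0}

lemma measurableSet_slab (s t : ℝ) : MeasurableSet (Ioc s t ×ˢ univ : Set (ℝ × ℝ)) :=
  measurableSet_Ioc.prod MeasurableSet.univ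

lemma measurableSet_firstPointIn (hN : IsPoissonRandomMeasure P N ν) (hC : MeasurableSet C)
    (hD : MeasurableSet D) (s t : ℝ) : MeasurableSet (firstPointIn N C D s t) :=
  (hN.measurable _ ((hC.union hD).inter (measurableSet_slab 0 s)) (measurableSet_singleton 0)).inter
    ((hN.measurable _ (hC.inter (measurableSet_slab s t)) (measurableSet_singleton 1)).inter
      (hN.measurable _ (hD.inter (measurableSet_slab s t)) (measurableSet_singleton 0)))

lemma measurableSet_firstPointInGrid (hN : IsPoissonRandomMeasure P N ν) (hC : MeasurableSet C)
    (hD : MeasurableSet D) : MeasurableSet (firstPointInGrid N C D) :=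
  MeasurableSet.iUnion fun _ => MeasurableSet.iUnion fun _ =>
    measurableSet_firstPointIn hN hC hD _ _

/-- The three counts are independent and their means add up to `L(t)`; the count that equals one
contributes the factor `∫ R` over `(s,t]`. -/
lemma measure_firstPointIn (hN : IsPoissonRandomMeasure P N ν) (hC : HasTimeDensity ν C R)
    (hD : HasTimeDensity ν D R') (hCD : Disjoint C D)
    (hc : ∀ᵐ u ∂volume.restrict (Ioi (0 : ℝ)), R u + R' u ≤ c) {s t : ℝ} (hs : 0 ≤ s)
    (hst : s ≤ t) :
    P (firstPointIn N C D s t) =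
      ENNReal.ofReal (Real.exp (-cumulative (fun u => R u + R' u) t)) *
        ∫⁻ u in Ioc s t, R u := by
  have hslab : Disjoint (Ioc 0 s ×ˢ (univ : Set ℝ)) (Ioc s t ×ˢ univ) := by
    rw [Set.disjoint_left]
    intro z h1 h2
    exact h1.1.2.not_gt h2.1.1
  have hsum : ∀ s t : ℝ, 0 ≤ s → ν (C ∩ Ioc s t ×ˢ univ) + ν (D ∩ Ioc s t ×ˢ univ) =
      ∫⁻ u in Ioc s t, (R u + R' u) := by
    intro s t hs
    rw [hC.measure_eq s t hs, hD.measure_eq s t hs, lintegral_add_left hC.measurable]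
  have hfirst : ν ((C ∪ D) ∩ Ioc 0 s ×ˢ univ) = ∫⁻ u in Ioc 0 s, (R u + R' u) := by
    rw [union_inter_distrib_right, measure_union
      (hCD.mono inter_subset_left inter_subset_left)
      (hD.measurableSet.inter (measurableSet_slab 0 s)), hsum 0 s le_rfl]
  have hfin := lintegral_Ioc_ne_top hc (s := s) (t := t) hs
  rw [← hsum s t hs] at hfin
  have htot : ν ((C ∪ D) ∩ Ioc 0 s ×ˢ univ) +
      (ν (C ∩ Ioc s t ×ˢ univ) + ν (D ∩ Ioc s t ×ˢ univ)) =
      ∫⁻ u in Ioc 0 t, (R u + R' u) := by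
    rw [hfirst, hsum s t hs, ← Ioc_union_Ioc_eq_Ioc hs hst, lintegral_union measurableSet_Ioc]
    rw [Set.disjoint_left]
    intro u h1 h2
    exact h1.2.not_gt h2.1
  rw [firstPointIn, hN.measure_only_second
    ((hC.measurableSet.union hD.measurableSet).inter (measurableSet_slab 0 s))
    (hC.measurableSet.inter (measurableSet_slab s t))
    (hD.measurableSet.inter (measurableSet_slab s t))
    (hslab.mono inter_subset_right inter_subset_right)
    (hslab.mono inter_subset_right inter_subset_right)
    (hCD.mono inter_subset_left inter_subset_left)
    (hfirst ▸ lintegral_Ioc_ne_top hc le_rfl)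
    (ENNReal.add_ne_top.1 hfin).1 (ENNReal.add_ne_top.1 hfin).2, htot, hC.measure_eq s t hs]
  rfl

/-- A single mesh suffices up to the factor `e^{-cδ}`: the events of its cells are disjoint, and on
a cell `L` at the right end exceeds `L u` by at most `cδ`. Two points in one cell are simply not
counted, which is why only a lower bound appears. -/
lemma le_measure_firstPointInGrid (hN : IsPoissonRandomMeasure P N ν) (hC : HasTimeDensity ν C R)
    (hD : HasTimeDensity ν D R') (hCD : Disjoint C D)
    (hc : ∀ᵐ u ∂volume.restrict (Ioi (0 : ℝ)), R u + R' u ≤ c) :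
    ∫⁻ u in Ioi 0, ENNReal.ofReal (Real.exp (-cumulative (fun u => R u + R' u) u)) * R u ≤
      P (firstPointInGrid N C D) := by
  refine le_of_forall_exp_mul_le c fun n => ?_
  refine le_trans ?_ (measure_mono (subset_iUnion _ n))
  set δ : ℝ := 1 / ((n : ℝ) + 1) with hδdef
  have hδ : 0 < δ := by positivity
  rw [measure_iUnion _ fun k => measurableSet_firstPointIn hN hC.measurableSet hD.measurableSet _ _,
    lintegral_Ioi_eq_tsum _ hδ, ← ENNReal.tsum_mul_left]
  · refine ENNReal.tsum_le_tsum fun k => ?_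
    have hs : 0 ≤ δ * k := by positivity
    have hst : δ * k ≤ δ * (k + 1) := by gcongr; linarith
    rw [measure_firstPointIn hN hC hD hCD hc hs hst, ← lintegral_const_mul' _ _ ENNReal.ofReal_ne_top,
      ← lintegral_const_mul' _ _ ENNReal.ofReal_ne_top]
    refine setLIntegral_mono' measurableSet_Ioc fun u hu => ?_
    rw [← mul_assoc, ← ENNReal.ofReal_mul (Real.exp_nonneg _), ← Real.exp_add]
    gcongr
    have h1 := cumulative_le_add hc (hs.trans hu.1.le) hu.2
    have h2 : (c : ℝ) * (δ * (k + 1) - u) ≤ c * δ := by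
      gcongr
      linarith [hu.1]
    linarith
  · have key : ∀ k l : ℕ, k < l → Disjoint (firstPointIn N C D (δ * k) (δ * (k + 1)))
        (firstPointIn N C D (δ * l) (δ * (l + 1))) := by
      intro k l hkl
      rw [Set.disjoint_left]
      rintro ω ⟨-, h1, -⟩ ⟨h2, -, -⟩
      have hkl' : (k : ℝ) + 1 ≤ l := by exact_mod_cast hkl
      have h3 : N ω (C ∩ Ioc (δ * k) (δ * (k + 1)) ×ˢ univ) = 0 := by
        refine measure_mono_null (inter_subset_inter subset_union_left
          (prod_mono (Ioc_subset_Ioc (by positivity) ?_) subset_rfl)) h2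
        gcongr
      simp [h3] at h1
    intro k l hkl
    rcases hkl.lt_or_gt with h | h
    · exact key k l h
    · exact (key l k h).symm

/-- If almost surely an event happens when the first point of `C ∪ D` is in `C`, and does not happen
when this point is in `D`, then its probability is `∫ e^{-∫(R + R')} R`. -/
theorem measure_eq_of_firstPointIn [IsProbabilityMeasure P] (hN : IsPoissonRandomMeasure P N ν)
    (hC : HasTimeDensity ν C R) (hD : HasTimeDensity ν D R') (hCD : Disjoint C D)
    (hc : ∀ᵐ u ∂volume.restrict (Ioi (0 : ℝ)), R u + R' u ≤ c)
    (htop : Tendsto (cumulative fun u => R u + R' u) atTop atTop) {A : Set Ω}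
    (hA : ∀ᵐ ω ∂P, ∀ s t, 0 ≤ s → s ≤ t → ω ∈ firstPointIn N C D s t → ω ∈ A)
    (hA' : ∀ᵐ ω ∂P, ∀ s t, 0 ≤ s → s ≤ t → ω ∈ firstPointIn N D C s t → ω ∉ A) :
    NullMeasurableSet A P ∧ P A =
      ∫⁻ u in Ioi 0, ENNReal.ofReal (Real.exp (-cumulative (fun u => R u + R' u) u)) * R u := by
  set F := firstPointInGrid N C D with hF
  set G := firstPointInGrid N D C with hG
  have hFm : MeasurableSet F := measurableSet_firstPointInGrid hN hC.measurableSet hD.measurableSet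
  have hGm : MeasurableSet G := measurableSet_firstPointInGrid hN hD.measurableSet hC.measurableSet
  have hgrid : ∀ n k : ℕ, 0 ≤ 1 / ((n : ℝ) + 1) * k ∧
      1 / ((n : ℝ) + 1) * k ≤ 1 / ((n : ℝ) + 1) * (k + 1) := by
    intro n k
    refine ⟨by positivity, ?_⟩
    gcongr
    linarith
  have hFA : ∀ᵐ ω ∂P, ω ∈ F → ω ∈ A := by
    filter_upwards [hA] with ω hω hωF
    obtain ⟨n, hn⟩ := mem_iUnion.1 hωF
    obtain ⟨k, hk⟩ := mem_iUnion.1 hn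
    exact hω _ _ (hgrid n k).1 (hgrid n k).2 hk
  have hGA : ∀ᵐ ω ∂P, ω ∈ G → ω ∉ A := by
    filter_upwards [hA'] with ω hω hωF
    obtain ⟨n, hn⟩ := mem_iUnion.1 hωF
    obtain ⟨k, hk⟩ := mem_iUnion.1 hn
    exact hω _ _ (hgrid n k).1 (hgrid n k).2 hk
  set L := cumulative fun u => R u + R' u with hL
  have hLm : Measurable L := measurable_cumulative hc
  have hF1 : ∫⁻ u in Ioi 0, ENNReal.ofReal (Real.exp (-L u)) * R u ≤ P F :=
    le_measure_firstPointInGrid hN hC hD hCD hc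
  have hG1 : ∫⁻ u in Ioi 0, ENNReal.ofReal (Real.exp (-L u)) * R' u ≤ P G := by
    have hcomm : (fun u => R u + R' u) = fun u => R' u + R u := by
      ext u; rw [add_comm]
    rw [hL, hcomm]
    exact le_measure_firstPointInGrid hN hD hC hCD.symm (by simpa only [add_comm] using hc)
  have hone : 1 ≤ (∫⁻ u in Ioi 0, ENNReal.ofReal (Real.exp (-L u)) * R u) +
      ∫⁻ u in Ioi 0, ENNReal.ofReal (Real.exp (-L u)) * R' u := by
    rw [← lintegral_add_left (by have := hC.measurable; fun_prop)]
    simp_rw [← mul_add]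
    exact one_le_lintegral_exp_neg_cumulative hc htop
  -- `F` forces `A` and `G` forces its complement, so the two cannot both occur, except on a null
  -- set.
  have hdisj : AEDisjoint P F G := by
    rw [AEDisjoint, measure_eq_zero_iff_ae_notMem]
    filter_upwards [hFA, hGA] with ω h1 h2 h3
    exact h2 h3.2 (h1 h3.1)
  have hsum : P F + P G ≤ 1 := by
    rw [← measure_union₀ hGm.nullMeasurableSet hdisj]
    exact prob_le_one
  -- Two lower bounds of sum at least one, for almost disjoint events, leave no slack in either of
  -- them.
  have hPF : P F = ∫⁻ u in Ioi 0, ENNReal.ofReal (Real.exp (-L u)) * R u := by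
    refine le_antisymm ?_ hF1
    refine (ENNReal.add_le_add_iff_right (measure_ne_top P G)).1 (hsum.trans (hone.trans ?_))
    gcongr
  have hFG : P (F ∪ G)ᶜ = 0 := by
    rw [prob_compl_eq_zero_iff (hFm.union hGm), measure_union₀ hGm.nullMeasurableSet hdisj]
    exact le_antisymm hsum (hone.trans (by gcongr))
  have hae : A =ᵐ[P] F := by
    filter_upwards [hFA, hGA, measure_eq_zero_iff_ae_notMem.1 hFG] with ω h1 h2 h3
    refine propext ⟨fun h => ?_, h1⟩
    by_contra hωF
    exact (not_not.1 h3).elim hωF fun hωG => h2 hωG h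
  exact ⟨hFm.nullMeasurableSet.congr hae.symm, (measure_congr hae).trans hPF⟩

end FirstPoint

/-! ### The regions that trigger the transitions -/

section Regions

variable {S : Set ℝ} {r : Pairs S → Pairs S → Prop} {lam lamT : Pairs S → ℝ → ℝ}

lemma supNorm_nonneg (f : ℝ → ℝ) : 0 ≤ supNorm f := ENNReal.toReal_nonneg

lemma tsum_ofReal_supNorm_ne_top (hlam : IsRateMatrix lam) :
    ∑' q, ENNReal.ofReal (supNorm (lam q)) ≠ ∞ := by
  rw [← ENNReal.ofReal_tsum_of_nonneg (fun q => supNorm_nonneg _) hlam.summable_norm]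
  exact ENNReal.ofReal_ne_top

variable (lam lamT) in
/-- The ages at which all `λ̃_q` take their generic value. -/
def genericAges : Set ℝ := {y | ∀ q, lamT q y = supNorm (lam q)}

lemma ae_mem_genericAges [Countable S] (hA3 : AssumptionA3 lam lamT) {a : ℝ} (ha : 0 ≤ a) :
    ∀ᵐ u : ℝ, 0 ≤ u → a + u ∈ genericAges lam lamT := by
  have h1 : ∀ᵐ y : ℝ, 0 ≤ y → y ∈ genericAges lam lamT := by
    have h2 : ∀ᵐ y ∂halfLine, ∀ q, lamT q y = supNorm (lam q) := ae_all_iff.2 hA3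
    exact (ae_restrict_iff' measurableSet_Ici).1 h2
  have h3 := (measurePreserving_add_left volume a).quasiMeasurePreserving.ae h1
  filter_upwards [h3] with u hu h0
  exact hu (add_nonneg ha h0)

lemma leftEnd_ne_top (hlam : IsRateMatrix lam) {y : ℝ} (hy : y ∈ genericAges lam lamT)
    (p : Pairs S) : leftEnd r lamT p y ≠ ∞ := by
  refine ne_top_of_le_ne_top (tsum_ofReal_supNorm_ne_top hlam) ?_
  have : leftEnd r lamT p y =
      ∑' q : {q : Pairs S // r q p}, ENNReal.ofReal (supNorm (lam q.1)) := by
    simp only [leftEnd]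
    congr with q
    rw [hy q.1]
  rw [this]
  exact ENNReal.tsum_comp_le_tsum_of_injective Subtype.val_injective _

lemma volume_jumpInterval (hlam : IsRateMatrix lam) {p : Pairs S} {y : ℝ} (h0 : 0 ≤ y)
    (hfin : leftEnd r lamT p y ≠ ∞) :
    volume (jumpInterval r lam lamT p y) = ENNReal.ofReal (lam p y) := by
  have h : jumpInterval r lam lamT p y =
      Ico (leftEnd r lamT p y).toReal ((leftEnd r lamT p y).toReal + lam p y) := by
    ext v
    have hl := (hlam.pos p y h0).le
    have hL : 0 ≤ (leftEnd r lamT p y).toReal := ENNReal.toReal_nonneg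
    constructor
    · rintro ⟨hv, h1, h2⟩
      rw [← ENNReal.ofReal_toReal hfin] at h1 h2
      rw [← ENNReal.ofReal_add hL hl] at h2
      exact ⟨(ENNReal.ofReal_le_ofReal_iff hv).1 h1, (ENNReal.ofReal_lt_ofReal_iff_of_nonneg hv).1 h2⟩
    · rintro ⟨h1, h2⟩
      refine ⟨hL.trans h1, ?_, ?_⟩
      · rw [← ENNReal.ofReal_toReal hfin]
        exact ENNReal.ofReal_le_ofReal h1
      · rw [← ENNReal.ofReal_toReal hfin, ← ENNReal.ofReal_add hL hl]
        exact (ENNReal.ofReal_lt_ofReal_iff_of_nonneg (hL.trans h1)).2 h2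
  rw [h, Real.volume_Ico]
  congr 1
  ring

variable {ι : Type*} (π : ι → Pairs S) (a : ι → ℝ)

variable (r lam lamT) in
/-- The space-time points which trigger one of the transitions in `Q`, where the transition `π p`
concerns a path of initial age `a p`. -/
def region (Q : Set ι) : Set (ℝ × ℝ) := ⋃ p ∈ Q, trigger r lam lamT (π p) (a p)

variable (lam) in
/-- The total rate of the transitions in `Q` at time `u`. -/
def regionRate (Q : Set ι) (u : ℝ) : ℝ≥0∞ :=
  ∑' p, Q.indicator (fun p => ENNReal.ofReal (lam (π p) (a p + u))) p

variable {π a}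

lemma measurableSet_region [Countable S] [Countable ι] (hlam : IsRateMatrix lam)
    (hsp : IsSpacing lam lamT) (Q : Set ι) : MeasurableSet (region r lam lamT π a Q) :=
  MeasurableSet.biUnion Q.to_countable fun _ _ => measurableSet_trigger hlam hsp _ _

lemma measurable_regionRate [Countable ι] (hlam : IsRateMatrix lam) (Q : Set ι) :
    Measurable (regionRate lam π a Q) := by
  classical
  refine Measurable.tsum fun p => ?_
  by_cases hp : p ∈ Q
  · have := hlam.measurable (π p)
    simp only [indicator_of_mem hp]
    fun_prop
  · simp only [indicator_of_notMem hp]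
    exact measurable_const

lemma regionRate_add_compl (Q : Set ι) (u : ℝ) :
    regionRate lam π a Q u + regionRate lam π a Qᶜ u =
      ∑' p, ENNReal.ofReal (lam (π p) (a p + u)) := by
  rw [regionRate, regionRate, ← ENNReal.tsum_add]
  congr with p
  exact congrFun (indicator_self_add_compl Q _) p

/-- At generic ages `λ_p ≤ λ̃_p = ‖λ_p‖_∞`, and injectivity of the labelling counts each norm at
most once, so (A1) gives a bound uniform in time. -/
lemma ae_regionRate_le [Countable S] [Countable ι] (hlam : IsRateMatrix lam)
    (hsp : IsSpacing lam lamT) (hA3 : AssumptionA3 lam lamT) (hπ : Function.Injective π)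
    (ha : ∀ p, 0 ≤ a p) :
    ∀ᵐ u ∂volume.restrict (Ioi (0 : ℝ)), ∑' p, ENNReal.ofReal (lam (π p) (a p + u)) ≤
      ((∑' q, ENNReal.ofReal (supNorm (lam q))).toNNReal : ℝ≥0∞) := by
  rw [ENNReal.coe_toNNReal (tsum_ofReal_supNorm_ne_top hlam),
    ae_restrict_iff' measurableSet_Ioi]
  have h := ae_all_iff.2 fun p => ae_mem_genericAges (lam := lam) hA3 (ha p)
  filter_upwards [h] with u hu h0
  have h0 : 0 < u := h0
  refine le_trans (ENNReal.tsum_le_tsum fun p => ?_)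
    (ENNReal.tsum_comp_le_tsum_of_injective hπ fun q => ENNReal.ofReal (supNorm (lam q)))
  refine ENNReal.ofReal_le_ofReal ?_
  rw [← hu p h0.le (π p)]
  exact hsp.le _ _ (by linarith [ha p])

lemma disjoint_jumpInterval_of_generic [IsStrictTotalOrder (Pairs S) r] (hsp : IsSpacing lam lamT)
    (hπ : Function.Injective π) (ha : ∀ p, 0 ≤ a p) {u : ℝ} (h0 : 0 ≤ u)
    (hu : ∀ p, a p + u ∈ genericAges lam lamT) {p q : ι} (hpq : p ≠ q) :
    Disjoint (jumpInterval r lam lamT (π p) (a p + u))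
      (jumpInterval r lam lamT (π q) (a q + u)) :=
  disjoint_jumpInterval hsp (add_nonneg (ha p) h0) (add_nonneg (ha q) h0)
    (fun l => by rw [hu p l, hu q l]) (hπ.ne hpq)

lemma ae_forall_mem_genericAges [Countable S] [Countable ι] (hA3 : AssumptionA3 lam lamT)
    (ha : ∀ p, 0 ≤ a p) :
    ∀ᵐ u ∂halfLine, ∀ p, a p + u ∈ genericAges lam lamT := by
  rw [halfLine, ae_restrict_iff' measurableSet_Ici]
  have h := ae_all_iff.2 fun p => ae_mem_genericAges (lam := lam) hA3 (ha p)
  filter_upwards [h] with u hu h0 p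
  exact hu p h0

/-- By Tonelli: at almost every time all ages are generic, and the time slice is a disjoint union of
intervals of lengths `λ_p`. The difference makes the regions genuinely disjoint; it removes only
overlaps at nongeneric times, a null set. -/
lemma hasTimeDensity_region [Countable S] [Countable ι] [IsStrictTotalOrder (Pairs S) r]
    (hlam : IsRateMatrix lam) (hsp : IsSpacing lam lamT) (hA3 : AssumptionA3 lam lamT)
    (hπ : Function.Injective π) (ha : ∀ p, 0 ≤ a p) {Q Q' : Set ι} (hQ : Disjoint Q' Q) :
    HasTimeDensity (halfLine.prod volume)
      (region r lam lamT π a Q' \ region r lam lamT π a Q) (regionRate lam π a Q') where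
  measurableSet := (measurableSet_region hlam hsp Q').diff (measurableSet_region hlam hsp Q)
  measurable := measurable_regionRate hlam Q'
  measure_eq s t hs := by
    classical
    have hm := ((measurableSet_region (r := r) (π := π) (a := a) hlam hsp Q').diff
      (measurableSet_region (r := r) (π := π) (a := a) hlam hsp Q)).inter (measurableSet_slab s t)
    have hsub : Ioc s t ⊆ Ici 0 := fun u hu => hs.trans hu.1.le
    rw [Measure.prod_apply hm]
    have : ∫⁻ u in Ioc s t, regionRate lam π a Q' u =
        ∫⁻ u, (Ioc s t).indicator (regionRate lam π a Q') u ∂halfLine := by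
      rw [lintegral_indicator measurableSet_Ioc, halfLine, Measure.restrict_restrict
        measurableSet_Ioc, inter_eq_left.2 hsub]
    rw [this]
    refine lintegral_congr_ae ?_
    filter_upwards [ae_forall_mem_genericAges hA3 ha] with u hu
    by_cases hut : u ∈ Ioc s t
    swap
    · rw [indicator_of_notMem hut]
      convert! measure_empty (μ := (volume : Measure ℝ))
      refine eq_empty_of_forall_notMem fun v hv => hut hv.2.1
    have h0 : 0 < u := hs.trans_lt hut.1
    rw [indicator_of_mem hut, regionRate, ← tsum_subtype]
    have hset : Prod.mk u ⁻¹' ((region r lam lamT π a Q' \ region r lam lamT π a Q) ∩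
        Ioc s t ×ˢ univ) = ⋃ p ∈ Q', jumpInterval r lam lamT (π p) (a p + u) := by
      ext v
      simp only [region, mem_preimage, mem_inter_iff, Set.mem_sdiff, mem_iUnion, trigger, mem_ofPred_eq,
        h0, true_and, mem_prod, hut, mem_univ, and_true, exists_prop, not_exists, not_and]
      refine ⟨fun h => h.1, fun h => ⟨h, fun q hq hqv => ?_⟩⟩
      obtain ⟨p, hp, hpv⟩ := h
      have hpq : p ≠ q := fun h => Set.disjoint_left.1 hQ hp (h ▸ hq)
      exact Set.disjoint_left.1 (disjoint_jumpInterval_of_generic hsp hπ ha h0.le hu hpq) hpv hqv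
    rw [hset, measure_biUnion Q'.to_countable
      (fun p _ q _ hpq => disjoint_jumpInterval_of_generic hsp hπ ha h0.le hu hpq)
      fun p _ => measurableSet_jumpInterval _ _]
    congr with p
    exact volume_jumpInterval hlam (add_nonneg (ha p) h0.le) (leftEnd_ne_top hlam (hu p) _)

/-- This is the decisive use of (A3): at generic times distinct intervals are disjoint, so overlaps
of triggers are null and almost surely carry no Poisson point. -/
lemma ae_trigger_inter_eq_zero [Countable S] [Countable ι] [IsStrictTotalOrder (Pairs S) r]
    {Ω : Type*} [MeasurableSpace Ω] {P : Measure Ω} [IsProbabilityMeasure P]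
    {N : Ω → Measure (ℝ × ℝ)} (hN : IsPoissonRandomMeasure P N (halfLine.prod volume))
    (hlam : IsRateMatrix lam) (hsp : IsSpacing lam lamT) (hA3 : AssumptionA3 lam lamT)
    (hπ : Function.Injective π) (ha : ∀ p, 0 ≤ a p) :
    ∀ᵐ ω ∂P, ∀ p q, p ≠ q →
      N ω (trigger r lam lamT (π p) (a p) ∩ trigger r lam lamT (π q) (a q)) = 0 := by
  rw [ae_all_iff]
  intro p
  rw [ae_all_iff]
  intro q
  by_cases hpq : p = q
  · simp [hpq]
  have hm : MeasurableSet (trigger r lam lamT (π p) (a p) ∩ trigger r lam lamT (π q) (a q)) :=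
    (measurableSet_trigger hlam hsp _ _).inter (measurableSet_trigger hlam hsp _ _)
  have h0 : (halfLine.prod volume)
      (trigger r lam lamT (π p) (a p) ∩ trigger r lam lamT (π q) (a q)) = 0 := by
    rw [Measure.measure_prod_null hm]
    filter_upwards [ae_forall_mem_genericAges hA3 ha] with u hu
    convert! measure_empty (μ := (volume : Measure ℝ))
    refine eq_empty_of_forall_notMem fun v hv => ?_
    exact Set.disjoint_left.1
      (disjoint_jumpInterval_of_generic hsp hπ ha (le_of_lt hv.1.1) hu hpq) hv.1.2 hv.2.2
  filter_upwards [hN.ae_eq_zero hm h0] with ω hω _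
  exact hω

/-- If the points of `C ∪ D` up to time `t` are a single point of `C`, then exactly one transition
is triggered up to time `t`. -/
lemma exists_trigger_of_firstPointIn [Countable S] [Countable ι] {Ω : Type*}
    {N : Ω → Measure (ℝ × ℝ)} {ω : Ω} (hμ : IntegerValued (N ω)) (hlam : IsRateMatrix lam)
    (hsp : IsSpacing lam lamT)
    (hpair : ∀ p q, p ≠ q →
      N ω (trigger r lam lamT (π p) (a p) ∩ trigger r lam lamT (π q) (a q)) = 0)
    {C D : Set (ℝ × ℝ)} {Q : Set ι} (hCQ : C ⊆ region r lam lamT π a Q)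
    (hCD : region r lam lamT π a univ ⊆ C ∪ D) {s t : ℝ} (hs : 0 ≤ s) (hst : s ≤ t)
    (hω : ω ∈ firstPointIn N C D s t) :
    ∃ p ∈ Q, N ω (trigger r lam lamT (π p) (a p) ∩ Ioc 0 t ×ˢ univ) = 1 ∧
      ∀ q ≠ p, N ω (trigger r lam lamT (π q) (a q) ∩ Ioc 0 t ×ˢ univ) = 0 := by
  obtain ⟨h1, h2, h3⟩ := hω
  have hW : ∀ p, MeasurableSet (trigger r lam lamT (π p) (a p) ∩ Ioc 0 t ×ˢ univ) := fun p =>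
    (measurableSet_trigger hlam hsp _ _).inter (measurableSet_slab 0 t)
  have hsub : ∀ p, trigger r lam lamT (π p) (a p) ∩ Ioc 0 t ×ˢ univ ⊆
      (C ∪ D) ∩ Ioc 0 t ×ˢ univ := fun p => by
    refine inter_subset_inter_left _ (Subset.trans ?_ hCD)
    exact subset_biUnion_of_mem (u := fun p => trigger r lam lamT (π p) (a p)) (mem_univ p)
  have htot : N ω ((C ∪ D) ∩ Ioc 0 t ×ˢ univ) ≤ 1 := by
    have h4 : (C ∪ D) ∩ Ioc 0 t ×ˢ univ ⊆ ((C ∪ D) ∩ Ioc 0 s ×ˢ univ) ∪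
        ((C ∩ Ioc s t ×ˢ univ) ∪ (D ∩ Ioc s t ×ˢ univ)) := by
      rw [← Ioc_union_Ioc_eq_Ioc hs hst, union_prod, inter_union_distrib_left,
        union_inter_distrib_right (s := C) (t := D) (u := Ioc s t ×ˢ univ)]
    refine (measure_mono h4).trans ((measure_union_le _ _).trans ?_)
    rw [h1, zero_add]
    refine (measure_union_le _ _).trans ?_
    rw [h2, h3, add_zero]
  obtain ⟨p, hp, hpne⟩ : ∃ p ∈ Q,
      N ω (trigger r lam lamT (π p) (a p) ∩ Ioc 0 t ×ˢ univ) ≠ 0 := by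
    by_contra! hall
    have : N ω (C ∩ Ioc s t ×ˢ univ) = 0 := by
      refine measure_mono_null ?_ ((measure_biUnion_null_iff Q.to_countable).2 hall)
      rintro z ⟨hzC, hz⟩
      obtain ⟨p, hp, hzp⟩ := mem_iUnion₂.1 (hCQ hzC)
      exact mem_iUnion₂.2 ⟨p, hp, hzp, ⟨hs.trans_lt hz.1.1, hz.1.2⟩, trivial⟩
    simp [this] at h2
  have hp1 := hμ.eq_one (hW p) hpne ((measure_mono (hsub p)).trans htot)
  refine ⟨p, hp, hp1, fun q hq => ?_⟩
  by_contra hne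
  have h5 := hμ.one_le (hW q) hne
  -- Two charged triggers would give mass two to a set of mass at most one.
  have hd : AEDisjoint (N ω) (trigger r lam lamT (π p) (a p) ∩ Ioc 0 t ×ˢ univ)
      (trigger r lam lamT (π q) (a q) ∩ Ioc 0 t ×ˢ univ) :=
    measure_mono_null (inter_subset_inter inter_subset_left inter_subset_left) (hpair p q hq.symm)
  have h6 := (measure_mono (union_subset (hsub p) (hsub q))).trans htot
  rw [measure_union₀ (hW q).nullMeasurableSet hd, hp1] at h6
  have : (1 : ℝ≥0∞) + 1 ≤ 1 := le_trans (by gcongr) h6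
  norm_num at this

end Regions

/-! ### Cumulative exit rates -/

section ExitRates

variable {S : Set ℝ} {lam : Pairs S → ℝ → ℝ}

lemma intervalIntegral_eq_cumulative {R : ℝ → ℝ≥0∞} {c : ℝ≥0} (hR : Measurable R)
    (hc : ∀ᵐ u ∂volume.restrict (Ioi (0 : ℝ)), R u ≤ c) {f : ℝ → ℝ}
    (hf : ∀ᵐ u ∂volume.restrict (Ioi (0 : ℝ)), f u = (R u).toReal) {u : ℝ} (hu : 0 ≤ u) :
    ∫ t in (0 : ℝ)..u, f t = cumulative R u := by
  have hsub : volume.restrict (Ioc 0 u) ≤ volume.restrict (Ioi (0 : ℝ)) :=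
    Measure.restrict_mono (fun t ht => ht.1) le_rfl
  rw [intervalIntegral.integral_of_le hu, integral_congr_ae (ae_mono hsub hf),
    integral_toReal hR.aemeasurable, cumulative]
  filter_upwards [ae_mono hsub hc] with t ht
  exact ht.trans_lt ENNReal.coe_lt_top

variable (lam) in
/-- The exit rate as an extended nonnegative number. -/
def extendedExitRate (i : S) (y : ℝ) : ℝ≥0∞ :=
  ∑' k : {k : S // k ≠ i}, ENNReal.ofReal (lam (pairTo i k) y)

lemma toReal_extendedExitRate (hlam : IsRateMatrix lam) (i : S) {y : ℝ} (hy : 0 ≤ y) :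
    (extendedExitRate lam i y).toReal = exitRate lam i y := by
  rw [extendedExitRate, ENNReal.tsum_toReal_eq fun _ => ENNReal.ofReal_ne_top, exitRate]
  congr with k
  exact ENNReal.toReal_ofReal (hlam.pos _ y hy).le

lemma measurable_extendedExitRate [Countable S] (hlam : IsRateMatrix lam) (i : S) :
    Measurable (extendedExitRate lam i) :=
  Measurable.tsum fun _ => (hlam.measurable _).ennreal_ofReal

lemma ae_extendedExitRate_le [Countable S] {lamT : Pairs S → ℝ → ℝ} (hlam : IsRateMatrix lam)
    (hsp : IsSpacing lam lamT) (hA3 : AssumptionA3 lam lamT) (i : S) {a : ℝ} (ha : 0 ≤ a) :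
    ∀ᵐ u ∂volume.restrict (Ioi (0 : ℝ)), extendedExitRate lam i (a + u) ≤
      ((∑' q, ENNReal.ofReal (supNorm (lam q))).toNNReal : ℝ≥0∞) :=
  ae_regionRate_le hlam hsp hA3 (a := fun _ => a) (pairTo_injective i) fun _ => ha

/-- Starting at age `a` only removes the finite mass on `(0,a]`, so (A2) persists. -/
lemma tendsto_cumulative_extendedExitRate [Countable S] {lamT : Pairs S → ℝ → ℝ}
    (hlam : IsRateMatrix lam) (hsp : IsSpacing lam lamT) (hA3 : AssumptionA3 lam lamT) (i : S)
    {a : ℝ} (ha : 0 ≤ a) :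
    Tendsto (cumulative fun u => extendedExitRate lam i (a + u)) atTop atTop := by
  have hm := measurable_extendedExitRate hlam i
  have hc : ∀ᵐ u ∂volume.restrict (Ioi (0 : ℝ)), extendedExitRate lam i u ≤
      ((∑' q, ENNReal.ofReal (supNorm (lam q))).toNNReal : ℝ≥0∞) := by
    simpa using ae_extendedExitRate_le hlam hsp hA3 i (le_refl (0 : ℝ))
  have h1 : Tendsto (cumulative (extendedExitRate lam i)) atTop atTop := by
    refine (hlam.tendsto_cumulative i).congr' ?_
    filter_upwards [eventually_ge_atTop 0] with u hu
    refine intervalIntegral_eq_cumulative hm hc ?_ hu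
    filter_upwards [ae_restrict_mem measurableSet_Ioi] with t ht
    exact (toReal_extendedExitRate hlam i (le_of_lt ht)).symm
  have h2 : Tendsto (fun u => cumulative (extendedExitRate lam i) (a + u) -
      cumulative (extendedExitRate lam i) a) atTop atTop :=
    tendsto_atTop_add_const_right _ _ (h1.comp (tendsto_atTop_add_const_left _ a tendsto_id))
  refine h2.congr' ?_
  filter_upwards [eventually_ge_atTop 0] with u hu
  rw [cumulative_add hc ha (le_add_of_nonneg_right hu), add_sub_cancel_left, cumulative]
  congr 1
  have h3 := (measurePreserving_add_left volume a).setLIntegral_comp_preimage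
    (measurableSet_Ioc (a := a) (b := a + u)) hm
  rw [← h3]
  simp

end ExitRates

/-! ### Meeting transitions and the probability of meeting -/

/-- The labels of the transitions of two paths in the states `i` and `j`. -/
abbrev TransitionLabel {S : Set ℝ} (i j : S) : Type := {k : S // k ≠ i} ⊕ {k : S // k ≠ j}

/-- The pair of states of a transition of one of two paths. -/
def labelPair {S : Set ℝ} (i j : S) : TransitionLabel i j → Pairs S :=
  Sum.elim (pairTo i) (pairTo j)

/-- The initial age of the path which a transition concerns. -/
def labelAge {S : Set ℝ} (i j : S) (y₁ y₂ : ℝ) : TransitionLabel i j → ℝ :=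
  Sum.elim (fun _ => y₁) fun _ => y₂

/-- The two transitions at which the paths meet. -/
def meetingLabels {S : Set ℝ} (i j : S) : Set (TransitionLabel i j) :=
  {p | Sum.elim (fun k => k.1 = j) (fun l => l.1 = i) p}

section Meeting

variable {S : Set ℝ} {r : Pairs S → Pairs S → Prop} {lam lamT : Pairs S → ℝ → ℝ} {i j : S}
  {y₁ y₂ : ℝ}

lemma inl_mem_meetingLabels {k : {k : S // k ≠ i}} : Sum.inl k ∈ meetingLabels i j ↔ k.1 = j :=
  Iff.rfl

lemma inr_mem_meetingLabels {l : {k : S // k ≠ j}} : Sum.inr l ∈ meetingLabels i j ↔ l.1 = i :=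
  Iff.rfl

/-- Since `i ≠ j`, transitions of the two paths start from different states and never share an
interval. -/
lemma labelPair_injective (hij : i ≠ j) : Function.Injective (labelPair i j) :=
  (pairTo_injective i).sumElim (pairTo_injective j) fun _ _ h =>
    hij (congrArg (fun p : Pairs S => p.1.1) h)

lemma labelAge_nonneg (hy₁ : 0 ≤ y₁) (hy₂ : 0 ≤ y₂) (p : TransitionLabel i j) :
    0 ≤ labelAge i j y₁ y₂ p := by
  rcases p with k | l <;> assumption

lemma regionRate_add_compl_eq (Q : Set (TransitionLabel i j)) (u : ℝ) :
    regionRate lam (labelPair i j) (labelAge i j y₁ y₂) Q u +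
      regionRate lam (labelPair i j) (labelAge i j y₁ y₂) Qᶜ u =
      extendedExitRate lam i (y₁ + u) + extendedExitRate lam j (y₂ + u) := by
  rw [regionRate_add_compl, Summable.tsum_sum ENNReal.summable ENNReal.summable]
  rfl

lemma regionRate_meetingLabels (hij : i ≠ j) (u : ℝ) :
    regionRate lam (labelPair i j) (labelAge i j y₁ y₂) (meetingLabels i j) u =
      ENNReal.ofReal (lam ⟨(i, j), hij⟩ (y₁ + u)) +
        ENNReal.ofReal (lam ⟨(j, i), hij.symm⟩ (y₂ + u)) := by
  classical
  rw [regionRate, Summable.tsum_sum ENNReal.summable ENNReal.summable,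
    tsum_eq_single (⟨j, hij.symm⟩ : {k : S // k ≠ i}), tsum_eq_single (⟨i, hij⟩ : {k : S // k ≠ j})]
  · rw [indicator_of_mem ((inl_mem_meetingLabels (j := j) (k := ⟨j, hij.symm⟩)).2 rfl),
      indicator_of_mem ((inr_mem_meetingLabels (i := i) (l := ⟨i, hij⟩)).2 rfl)]
    rfl
  · intro l hl
    exact indicator_of_notMem (fun h => hl (Subtype.ext (inr_mem_meetingLabels.1 h))) _
  · intro k hk
    exact indicator_of_notMem (fun h => hk (Subtype.ext (inl_mem_meetingLabels.1 h))) _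

/-- If the transition `p` is the only one that is triggered up to time `t`, then the paths meet at
the first collective transition exactly if `p` is one of the two meeting transitions. -/
lemma meets_iff_mem_meetingLabels [Countable S] [IsStrictTotalOrder (Pairs S) r]
    (hsp : IsSpacing lam lamT) {μ : Measure (ℝ × ℝ)} (hμ : IntegerValued μ) {x₁ x₂ : ℝ → S}
    {a₁ a₂ : ℝ → ℝ} (h₁ : IsSolutionPath r lam lamT μ i y₁ x₁ a₁)
    (h₂ : IsSolutionPath r lam lamT μ j y₂ x₂ a₂) (hy₁ : 0 ≤ y₁) (hy₂ : 0 ≤ y₂) {t : ℝ}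
    {p : TransitionLabel i j}
    (hp : μ (trigger r lam lamT (labelPair i j p) (labelAge i j y₁ y₂ p) ∩ Ioc 0 t ×ˢ univ) = 1)
    (hq : ∀ q ≠ p,
      μ (trigger r lam lamT (labelPair i j q) (labelAge i j y₁ y₂ q) ∩ Ioc 0 t ×ˢ univ) = 0) :
    (∃ T : ℝ, collectiveTime x₁ x₂ 1 = (T : EReal) ∧ x₁ T = x₂ T ∧ min (a₁ T) (a₂ T) = 0) ↔
      p ∈ meetingLabels i j := by
  rcases p with k | l
  · exact meets_iff_of_transition hsp hμ h₁ h₂ hy₁ hp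
      (fun k' hk' => hq (Sum.inl k') (Sum.inl_injective.ne hk')) fun l => hq (Sum.inr l) (by simp)
  · have h := meets_iff_of_transition hsp hμ h₂ h₁ hy₂ hp
      (fun k' hk' => hq (Sum.inr k') (Sum.inr_injective.ne hk')) fun k => hq (Sum.inl k) (by simp)
    rw [collectiveTime_one_comm] at h
    simp_rw [min_comm (a₂ _), eq_comm (a := x₂ _)] at h
    exact h

end Meeting

/-- The probability of a meeting at the next transition, as an integral of extended nonnegative
numbers. -/
theorem measure_meetsAtNextTransition {Ω : Type*} [MeasurableSpace Ω] {P : Measure Ω}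
    [IsProbabilityMeasure P] {S : Set ℝ} [Countable S] {r : Pairs S → Pairs S → Prop}
    [IsStrictTotalOrder (Pairs S) r] {lam lamT : Pairs S → ℝ → ℝ} (hlam : IsRateMatrix lam)
    (hsp : IsSpacing lam lamT) (hA3 : AssumptionA3 lam lamT) {N : Ω → Measure (ℝ × ℝ)}
    (hN : IsPoissonRandomMeasure P N (halfLine.prod volume)) {i j : S} (hij : i ≠ j) {y₁ y₂ : ℝ}
    (hy₁ : 0 ≤ y₁) (hy₂ : 0 ≤ y₂) {X₁ X₂ : ℝ → Ω → S} {Y₁ Y₂ : ℝ → Ω → ℝ}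
    (h₁ : IsSolution P r lam lamT N i y₁ X₁ Y₁) (h₂ : IsSolution P r lam lamT N j y₂ X₂ Y₂) :
    NullMeasurableSet (meetsAtNextTransition X₁ X₂ Y₁ Y₂) P ∧
    P (meetsAtNextTransition X₁ X₂ Y₁ Y₂) =
      ∫⁻ u in Ioi 0, ENNReal.ofReal (Real.exp (-cumulative (fun u =>
        extendedExitRate lam i (y₁ + u) + extendedExitRate lam j (y₂ + u)) u)) *
        (ENNReal.ofReal (lam ⟨(i, j), hij⟩ (y₁ + u)) +
          ENNReal.ofReal (lam ⟨(j, i), hij.symm⟩ (y₂ + u))) := by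
  set π := labelPair i j
  set a := labelAge i j y₁ y₂
  set Q := meetingLabels i j with hQ
  have hπ : Function.Injective π := labelPair_injective hij
  have ha : ∀ p, 0 ≤ a p := labelAge_nonneg hy₁ hy₂
  have hpair := ae_trigger_inter_eq_zero (r := r) hN hlam hsp hA3 hπ ha
  have hC : HasTimeDensity (halfLine.prod volume) (region r lam lamT π a Q)
      (regionRate lam π a Q) := by
    -- Removing the region of the empty set of labels leaves the region of `Q` itself.
    have := hasTimeDensity_region (r := r) hlam hsp hA3 hπ ha (disjoint_empty Q)
    simpa [region] using this
  have hD := hasTimeDensity_region (r := r) hlam hsp hA3 hπ ha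
    (disjoint_compl_left : Disjoint Qᶜ Q)
  have hcover : region r lam lamT π a univ ⊆ region r lam lamT π a Q ∪
      (region r lam lamT π a Qᶜ \ region r lam lamT π a Q) := by
    rw [union_sdiff_self, region, region, region, ← biUnion_union, union_compl_self]
  have hrate : (fun u => regionRate lam π a Q u + regionRate lam π a Qᶜ u) = fun u =>
      extendedExitRate lam i (y₁ + u) + extendedExitRate lam j (y₂ + u) :=
    funext fun u => regionRate_add_compl_eq Q u
  have hbound : ∀ᵐ u ∂volume.restrict (Ioi (0 : ℝ)),
      regionRate lam π a Q u + regionRate lam π a Qᶜ u ≤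
        ((∑' q, ENNReal.ofReal (supNorm (lam q))).toNNReal : ℝ≥0∞) := by
    simp_rw [regionRate_add_compl]
    exact ae_regionRate_le hlam hsp hA3 hπ ha
  -- The divergence of the exit rate of one path is enough.
  have htop : Tendsto (cumulative fun u => regionRate lam π a Q u + regionRate lam π a Qᶜ u)
      atTop atTop := by
    refine tendsto_atTop_mono (fun u => ?_)
      (tendsto_cumulative_extendedExitRate hlam hsp hA3 i hy₁)
    refine ENNReal.toReal_mono (lintegral_Ioc_ne_top hbound le_rfl) (lintegral_mono fun t => ?_)
    rw [regionRate_add_compl_eq]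
    exact le_self_add
  have hmain := measure_eq_of_firstPointIn hN hC hD disjoint_sdiff_right hbound htop
    (A := meetsAtNextTransition X₁ X₂ Y₁ Y₂) ?_ ?_
  · rw [hrate] at hmain
    simpa only [π, a, hQ, regionRate_meetingLabels hij] using hmain
  · filter_upwards [hpair, hN.integer_valued, h₁, h₂] with ω hω hμ hω₁ hω₂ s t hs hst hF
    obtain ⟨p, hpQ, hp, hq⟩ := exists_trigger_of_firstPointIn hμ hlam hsp hω subset_rfl hcover
      hs hst hF
    exact (meets_iff_mem_meetingLabels hsp hμ hω₁ hω₂ hy₁ hy₂ hp hq).2 hpQ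
  · filter_upwards [hpair, hN.integer_valued, h₁, h₂] with ω hω hμ hω₁ hω₂ s t hs hst hF hmeet
    obtain ⟨p, hpQ, hp, hq⟩ := exists_trigger_of_firstPointIn hμ hlam hsp hω sdiff_subset
      (hcover.trans_eq (union_comm _ _)) hs hst hF
    exact hpQ ((meets_iff_mem_meetingLabels hsp hμ hω₁ hω₂ hy₁ hy₂ hp hq).1 hmeet)

end SemiMarkovFlow

end

/-! ### Passage to real-valued integrals -/

open SemiMarkovFlow

theorem mainTheorem4 {Ω : Type*} [MeasurableSpace Ω] (P : MeasureTheory.Measure Ω)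
    [MeasureTheory.IsProbabilityMeasure P]
    (S : Set ℝ) (hS : S.Countable)
    (r : SemiMarkovFlow.Pairs S → SemiMarkovFlow.Pairs S → Prop)
    (hr : IsStrictTotalOrder (SemiMarkovFlow.Pairs S) r)
    (lam lamT : SemiMarkovFlow.Pairs S → ℝ → ℝ)
    (hlam : SemiMarkovFlow.IsRateMatrix lam)
    (hlamT : SemiMarkovFlow.IsSpacing lam lamT)
    (hA3 : SemiMarkovFlow.AssumptionA3 lam lamT)
    (N : Ω → MeasureTheory.Measure (ℝ × ℝ))
    (hN : SemiMarkovFlow.IsPoissonRandomMeasure P N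
      (SemiMarkovFlow.halfLine.prod MeasureTheory.volume))
    (i j : S) (hij : i ≠ j) (y₁ y₂ : ℝ) (hy₁ : 0 ≤ y₁) (hy₂ : 0 ≤ y₂)
    (X₁ X₂ : ℝ → Ω → S) (Y₁ Y₂ : ℝ → Ω → ℝ)
    (h₁ : SemiMarkovFlow.IsSolution P r lam lamT N i y₁ X₁ Y₁)
    (h₂ : SemiMarkovFlow.IsSolution P r lam lamT N j y₂ X₂ Y₂) :
    MeasureTheory.NullMeasurableSet
      (SemiMarkovFlow.meetsAtNextTransition X₁ X₂ Y₁ Y₂) P ∧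
    MeasureTheory.IntegrableOn
      (fun y : ℝ =>
        Real.exp (-∫ t in (0 : ℝ)..y,
          (SemiMarkovFlow.exitRate lam i (y₁ + t) + SemiMarkovFlow.exitRate lam j (y₂ + t))) *
        (lam ⟨(i, j), hij⟩ (y₁ + y) + lam ⟨(j, i), hij.symm⟩ (y₂ + y)))
      (Set.Ioi 0) ∧
    P.real (SemiMarkovFlow.meetsAtNextTransition X₁ X₂ Y₁ Y₂) =
      ∫ y in Set.Ioi (0 : ℝ),
        Real.exp (-∫ t in (0 : ℝ)..y,
          (SemiMarkovFlow.exitRate lam i (y₁ + t) + SemiMarkovFlow.exitRate lam j (y₂ + t))) *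
        (lam ⟨(i, j), hij⟩ (y₁ + y) + lam ⟨(j, i), hij.symm⟩ (y₂ + y)) := by
  have : Countable S := hS.to_subtype
  obtain ⟨hnull, hP⟩ := measure_meetsAtNextTransition hlam hlamT hA3 hN hij hy₁ hy₂ h₁ h₂
  refine ⟨hnull, ?_⟩
  have hm₁ := measurable_extendedExitRate hlam i
  have hm₂ := measurable_extendedExitRate hlam j
  have hR : Measurable fun u => extendedExitRate lam i (y₁ + u) +
    extendedExitRate lam j (y₂ + u) := by fun_prop
  set c := (∑' q, ENNReal.ofReal (supNorm (lam q))).toNNReal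
  have hc₁ := ae_extendedExitRate_le hlam hlamT hA3 i hy₁
  have hc₂ := ae_extendedExitRate_le hlam hlamT hA3 j hy₂
  have hc : ∀ᵐ u ∂volume.restrict (Ioi (0 : ℝ)), extendedExitRate lam i (y₁ + u) +
      extendedExitRate lam j (y₂ + u) ≤ ((c + c : ℝ≥0) : ℝ≥0∞) := by
    filter_upwards [hc₁, hc₂] with u hu₁ hu₂
    push_cast
    exact add_le_add hu₁ hu₂
  set L := cumulative fun u => extendedExitRate lam i (y₁ + u) +
    extendedExitRate lam j (y₂ + u) with hL
  have hint : ∀ u, 0 ≤ u → ∫ t in (0 : ℝ)..u,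
      (exitRate lam i (y₁ + t) + exitRate lam j (y₂ + t)) = L u := by
    intro u hu
    refine intervalIntegral_eq_cumulative hR hc ?_ hu
    filter_upwards [hc₁, hc₂, ae_restrict_mem measurableSet_Ioi] with t ht₁ ht₂ ht
    have ht : 0 < t := ht
    rw [ENNReal.toReal_add (ne_top_of_le_ne_top ENNReal.coe_ne_top ht₁)
      (ne_top_of_le_ne_top ENNReal.coe_ne_top ht₂),
      toReal_extendedExitRate hlam i (by linarith), toReal_extendedExitRate hlam j (by linarith)]
  set G : ℝ → ℝ≥0∞ := fun u => ENNReal.ofReal (Real.exp (-L u)) *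
    (ENNReal.ofReal (lam ⟨(i, j), hij⟩ (y₁ + u)) +
      ENNReal.ofReal (lam ⟨(j, i), hij.symm⟩ (y₂ + u))) with hG
  have hGm : Measurable G := by
    have h1 := measurable_cumulative hc
    have h2 := hlam.measurable ⟨(i, j), hij⟩
    have h3 := hlam.measurable ⟨(j, i), hij.symm⟩
    fun_prop
  -- Convergence of the integral is free, because its value is a probability.
  have hGfin : ∫⁻ u in Ioi 0, G u ≠ ∞ := hP ▸ measure_ne_top P _
  have hGeq : EqOn (fun u => (G u).toReal) (fun y : ℝ =>
      Real.exp (-∫ t in (0 : ℝ)..y, (exitRate lam i (y₁ + t) + exitRate lam j (y₂ + t))) *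
        (lam ⟨(i, j), hij⟩ (y₁ + y) + lam ⟨(j, i), hij.symm⟩ (y₂ + y))) (Ioi 0) := by
    intro u hu
    have hu : 0 < u := hu
    have h2 := (hlam.pos ⟨(i, j), hij⟩ (y₁ + u) (by linarith)).le
    have h3 := (hlam.pos ⟨(j, i), hij.symm⟩ (y₂ + u) (by linarith)).le
    simp only [hG]
    rw [hint u hu.le, ← ENNReal.ofReal_add h2 h3, ← ENNReal.ofReal_mul (Real.exp_nonneg _),
      ENNReal.toReal_ofReal (by positivity)]
  refine ⟨IntegrableOn.congr_fun (integrable_toReal_of_lintegral_ne_top hGm.aemeasurable hGfin)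
    hGeq measurableSet_Ioi, ?_⟩
  rw [← setIntegral_congr_fun measurableSet_Ioi hGeq, integral_toReal hGm.aemeasurable
    (ae_lt_top hGm hGfin), measureReal_def, hP]
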